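/- Let $\Gamma$ be a finitely generated discrete group, let $G$ be a compact connected Lie group acting smoothly and locally freely (i.e. with discrete isotropy groups) on a closed smooth manifold $M$, and let $H\le\Gamma$ be a subgroup of finite index $n$. Let $\varphi$ be a multiplicative orbifold invariant: a function, with values in a commutative ring, on a class of Morita equivalence classes of orbifold groupoids (proper étale Lie groupoids), with $\varphi(\mathcal G\times\mathcal H)=\varphi(\mathcal G)\varphi(\mathcal H)$; it is evaluated on every Lie groupoid that is Morita equivalent to an orbifold groupoid in the class, in particular on translation groupoids $X\rtimes K$. (Terms on which $\varphi$ is not defined are read as $0$.) For $\rho\in\mathrm{HOM}(H,G)$ let $M^{\langle\rho\rangle}$ be the set of points of $M$ fixed by $\rho(H)$, let $P_\rho=\Gamma\times_\rho G\to\Gamma/H$ be the quotient of $\Gamma\times G$ by $(\gamma h,g)\sim(\gamma,\rho(h)g)$, $h\in H$, and let $\mathrm{Aut}^{P_\rho}_{\Gamma\text{-}G}$ be the group of $\Gamma$-equivariant automorphisms of this principal $G$-bundle (covering arbitrary bijections of $\Gamma/H$). It acts on $M^{\langle\rho\rangle}$, identified with the set of $\Gamma$-invariant sections of $P_\rho\times_G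 M$; explicitly, if $(u,g)\in N_\Gamma(H)\times G$ stabilizes $\rho$ under the action $(\rho(u,g))(h)=g^{-1}\rho(uhu^{-1})g$ of $N_\Gamma(H)\times G$ on $\mathrm{HOM}(H,G)$, then the automorphism $[\gamma,k]\mapsto[\gamma u^{-1},gk]$ acts by $x\mapsto gx$. The $(\Gamma/H)$-extension of $\varphi$ is $$\varphi_{(\Gamma/H)}(M\rtimes G)=\sum_{[\rho]\in \mathrm{HOM}(H,G)/(N_\Gamma(H)\times G)}\varphi\left(M^{\langle\rho\rangle}\rtimes \mathrm{Aut}^{P_\rho}_{\Gamma\text{-}G}\right),$$ where terms with $M^{\langle\rho\rangle}=\emptyset$ are taken to be $0$. Let $G(\mathcal S_n)=G^n\rtimes\mathcal S_n$ be the wreath product, with $((g_i),s)((h_i),t)=((g_ih_{s^{-1}(i)}),st)$, acting on $M^n$ by $((g_i),s)(x_i)=(g_ix_{s^{-1}(i)})$. For a homomorphism $\tau:\Gamma\to G(\mathcal S_n)$ let $(M^n)^{\langle\tau\rangle}$ be the set of points of $M^n$ fixed by $\tau(\Gamma)$ and $C_{G(\mathcal S_n)}(\tau)$ the centralizer of $\tau(\Gamma)$.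 Let $$\pi:\mathrm{HOM}(\Gamma,G(\mathcal S_n))/G(\mathcal S_n)\to\mathrm{HOM}(\Gamma,\mathcal S_n)/\mathcal S_n$$ be composition with the projection $G(\mathcal S_n)\to\mathcal S_n$, where quotients are by conjugation, and identify $\mathrm{HOM}(\Gamma,\mathcal S_n)/\mathcal S_n$ with the set of isomorphism classes of $\Gamma$-sets of order $n$; let $(\Gamma/H)$ denote the isomorphism class of the $\Gamma$-set $\Gamma/H$. Then $$\varphi_{(\Gamma/H)}(M\rtimes G)=\sum_{(\tau)\in\pi^{-1}((\Gamma/H))}\varphi\left((M^n)^{\langle\tau\rangle}\rtimes C_{G(\mathcal S_n)}(\tau)\right),$$ where terms with $(M^n)^{\langle\tau\rangle}=\emptyset$ are taken to be $0$. Moreover both sums are finite: $M^{\langle\rho\rangle}\neq\emptyset$ for only finitely many classes $[\rho]$, and $(M^n)^{\langle\tau\rangle}\neq\emptyset$ for only finitely many classes $(\tau)\in\pi^{-1}((\Gamma/H))$. -/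

import Mathlib

open scoped Manifold ContDiff Topology

universe u v w

noncomputable section

namespace OrbifoldExtension

open Diffeology

/-! ### Diffeologies

Smooth structures are recorded as diffeologies. Smooth manifolds embed fully faithfully into
diffeological spaces, and the diffeology of a submanifold (possibly with components of different
dimensions) is the subset diffeology, so fixed point sets and closed subgroups receive their usual
smooth structure from the constructions below. -/

section Diffeologies

/-- The coarsest diffeology on `X` making `f : X → Y` smooth. -/
@[reducible] def induced {X : Type u} {Y : Type v} [DiffeologicalSpace Y] (f : X → Y) :
    DiffeologicalSpace X where
  plots _ := {p | IsPlot (f ∘ p)}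
  constant_plots x := isPlot_const (x := f x)
  plot_reparam {_ _ p _} hp hf := isPlot_reparam (p := f ∘ p) hp hf
  locality hp := DiffeologicalSpace.locality fun x ↦ by
    obtain ⟨U, hU, hx, h⟩ := hp x
    exact ⟨U, hU, hx, fun hm hf ↦ h hm hf⟩

/-- The finest diffeology on `Y` making `f : X → Y` smooth (the quotient diffeology when `f` is
surjective). -/
@[reducible] def coinduced {X : Type u} {Y : Type v} [DiffeologicalSpace X] (f : X → Y) :
    DiffeologicalSpace Y :=
  DiffeologicalSpace.generateFrom {q | ∃ p : EuclideanSpace ℝ (Fin q.1) → X, IsPlot p ∧ q.2 = f ∘ p}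

/-- The discrete diffeology, whose plots are the locally constant maps. -/
@[reducible] def discreteDiffeology (X : Type u) : DiffeologicalSpace X := ⊥

instance subtypeDiffeology {X : Type u} [DiffeologicalSpace X] (P : X → Prop) :
    DiffeologicalSpace (Subtype P) :=
  induced Subtype.val

instance prodDiffeology {X : Type u} {Y : Type v} [DiffeologicalSpace X] [DiffeologicalSpace Y] :
    DiffeologicalSpace (X × Y) :=
  induced Prod.fst ⊓ induced Prod.snd

theorem isPlot_prod_iff {X : Type u} {Y : Type v} [dX : DiffeologicalSpace X]
    [dY : DiffeologicalSpace Y] {n : ℕ} {p : EuclideanSpace ℝ (Fin n) → X × Y} :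
    IsPlot p ↔ IsPlot (fun r ↦ (p r).1) ∧ IsPlot (fun r ↦ (p r).2) :=
  @DiffeologicalSpace.isPlot_inf_iff _ (induced Prod.fst) (induced Prod.snd) n p

instance piDiffeology {ι : Type u} {X : ι → Type v} [∀ i, DiffeologicalSpace (X i)] :
    DiffeologicalSpace (∀ i, X i) :=
  ⨅ i, induced (fun x ↦ x i)

/-- The standard diffeology of a smooth manifold: the plots are the smooth maps from Euclidean
spaces. -/
@[reducible] def manifoldDiffeology {E : Type*} [NormedAddCommGroup E] [NormedSpace ℝ E]
    {B : Type*} [TopologicalSpace B] (I : ModelWithCorners ℝ E B)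
    (M : Type u) [TopologicalSpace M] [ChartedSpace B M] : DiffeologicalSpace M :=
  .ofCorePlotsOn {
    isPlotOn := fun {n U} _ p ↦ ContMDiffOn (𝓡 n) I ∞ p U
    isPlotOn_congr := fun _ _ _ h ↦ contMDiffOn_congr (fun x hx ↦ h hx)
    isPlot := fun {n} p ↦ ContMDiff (𝓡 n) I ∞ p
    isPlotOn_univ := contMDiffOn_univ
    isPlot_const := fun _ ↦ contMDiff_const
    isPlotOn_reparam := fun _ _ _ h hp hf ↦ hp.comp hf.contMDiffOn h
    locality := fun _ _ h ↦ fun x hx ↦ by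
      obtain ⟨V, hV, hxV, hp⟩ := h x hx
      exact ((hp x hxV).contMDiffAt (hV.mem_nhds hxV)).contMDiffWithinAt }

/-- The coarsest diffeology on a family `A` of maps `X → Y`, given by `ev`, for which evaluation
is jointly smooth along plots: the functional diffeology. -/
@[reducible] def functionalDiffeology {A : Type u} {X : Type v} {Y : Type w} [DiffeologicalSpace X]
    [DiffeologicalSpace Y] (ev : A → X → Y) (hev : ∀ a, DSmooth (ev a)) :
    DiffeologicalSpace A where
  plots n := {p | DSmooth fun z : EuclideanSpace ℝ (Fin n) × X ↦ ev (p z.1) z.2}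
  constant_plots a := (hev a).comp (fun _ _ hq ↦ (isPlot_prod_iff.1 hq).2)
  plot_reparam {n m p f} hp hf := fun k q hq ↦ by
    have hq' := isPlot_prod_iff.1 hq
    exact hp k (fun r ↦ (f (q r).1, (q r).2))
      (isPlot_prod_iff.2 ⟨hf.dSmooth k _ hq'.1, hq'.2⟩)
  locality {n p} hp := fun k q hq ↦ by
    have hq' := isPlot_prod_iff.1 hq
    have h1 : ContDiff ℝ ∞ (Prod.fst ∘ q) := IsPlot.contDiff hq'.1
    refine DiffeologicalSpace.locality fun r ↦ ?_
    obtain ⟨U, hU, hr, h⟩ := hp (q r).1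
    refine ⟨(Prod.fst ∘ q) ⁻¹' U, hU.preimage h1.continuous, hr, fun {m f} hf hfs ↦ ?_⟩
    have h2 := h (m := m) (f := (Prod.fst ∘ q) ∘ f) hf (h1.comp hfs)
    exact h2 m (fun t ↦ (t, (q (f t)).2))
      (isPlot_prod_iff.2 ⟨isPlot_id, isPlot_reparam hq'.2 hfs⟩)

/-- A diffeomorphism: a bijection that is smooth together with its inverse. -/
def IsDiffeo {X : Type u} {Y : Type v} [DiffeologicalSpace X] [DiffeologicalSpace Y]
    (f : X → Y) : Prop :=
  ∃ e : X ≃ Y, ⇑e = f ∧ DSmooth e ∧ DSmooth e.symm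

/-- A diffeological space is a smooth manifold if it is Hausdorff, second countable and every
point has an open neighbourhood diffeomorphic to some `ℝⁿ`. Different components may have different
dimensions, and the empty space is allowed. -/
def IsSmoothManifold (X : Type u) [DiffeologicalSpace X] : Prop :=
  @T2Space X dTopology ∧ @SecondCountableTopology X dTopology ∧
    ∀ x : X, ∃ U : Set X, IsOpen[dTopology] U ∧ x ∈ U ∧
      ∃ (n : ℕ) (f : U → EuclideanSpace ℝ (Fin n)), IsDiffeo f

/-- A smooth map (between manifolds) is a submersion if it admits a smooth local section through
every point of its source. -/
def IsSubmersion {X : Type u} {Y : Type v} [DiffeologicalSpace X] [DiffeologicalSpace Y]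
    (f : X → Y) : Prop :=
  DSmooth f ∧ ∀ x : X, ∃ V : Set Y, IsOpen[dTopology] V ∧ ∃ hx : f x ∈ V, ∃ σ : V → X,
    DSmooth σ ∧ (∀ y, f (σ y) = y) ∧ σ ⟨f x, hx⟩ = x

/-- A local diffeomorphism: every point has an open neighbourhood mapped diffeomorphically onto an
open set. -/
def IsLocalDiffeo {X : Type u} {Y : Type v} [DiffeologicalSpace X] [DiffeologicalSpace Y]
    (f : X → Y) : Prop :=
  ∀ x : X, ∃ U : Set X, IsOpen[dTopology] U ∧ x ∈ U ∧ IsOpen[dTopology] (f '' U) ∧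
    IsDiffeo (fun y : U ↦ (⟨f y, Set.mem_image_of_mem f y.2⟩ : ↥(f '' U)))

end Diffeologies

/-! ### Lie groupoids, Morita equivalence, orbifold groupoids -/

/-- A groupoid (objects, arrows, source, target, units, inverses, composition) whose sets of objects
and arrows carry diffeologies. The composite `comp g h _` is `g` after `h`. Smoothness of the
structure is part of the predicate `IsLie` below. -/
structure DiffGroupoid : Type (u + 1) where
  Obj : Type u
  Arr : Type u
  objDiffeology : DiffeologicalSpace Obj
  arrDiffeology : DiffeologicalSpace Arr
  src : Arr → Obj
  tgt : Arr → Obj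
  one : Obj → Arr
  inv : Arr → Arr
  comp : ∀ g h : Arr, src g = tgt h → Arr
  src_one : ∀ x, src (one x) = x
  tgt_one : ∀ x, tgt (one x) = x
  src_inv : ∀ g, src (inv g) = tgt g
  tgt_inv : ∀ g, tgt (inv g) = src g
  src_comp : ∀ g h e, src (comp g h e) = src h
  tgt_comp : ∀ g h e, tgt (comp g h e) = tgt g
  comp_one : ∀ g, comp g (one (src g)) (tgt_one (src g)).symm = g
  one_comp : ∀ g, comp (one (tgt g)) g (src_one (tgt g)) = g
  comp_inv : ∀ g, comp g (inv g) (tgt_inv g).symm = one (tgt g)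
  inv_comp : ∀ g, comp (inv g) g (src_inv g) = one (src g)
  assoc : ∀ g h k (e : src g = tgt h) (e' : src h = tgt k),
    comp (comp g h e) k ((src_comp g h e).trans e') =
      comp g (comp h k e') (e.trans (tgt_comp h k e').symm)

attribute [instance] DiffGroupoid.objDiffeology DiffGroupoid.arrDiffeology

namespace DiffGroupoid

/-- Lie groupoids: objects and arrows form manifolds, all structure maps are smooth, and source and
target are submersions. -/
def IsLie (X : DiffGroupoid.{u}) : Prop :=
  IsSmoothManifold X.Obj ∧ IsSmoothManifold X.Arr ∧
  IsSubmersion X.src ∧ IsSubmersion X.tgt ∧ DSmooth X.one ∧ DSmooth X.inv ∧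
  DSmooth (fun p : {p : X.Arr × X.Arr // X.src p.1 = X.tgt p.2} ↦ X.comp p.1.1 p.1.2 p.2)

/-- Homomorphisms of groupoids that are smooth on objects and on arrows. -/
structure Hom (X Y : DiffGroupoid.{u}) where
  obj : X.Obj → Y.Obj
  arr : X.Arr → Y.Arr
  smooth_obj : DSmooth obj
  smooth_arr : DSmooth arr
  src_arr : ∀ g, Y.src (arr g) = obj (X.src g)
  tgt_arr : ∀ g, Y.tgt (arr g) = obj (X.tgt g)
  map_one : ∀ x, arr (X.one x) = Y.one (obj x)
  map_comp : ∀ g h (e : X.src g = X.tgt h), arr (X.comp g h e) =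
    Y.comp (arr g) (arr h) ((src_arr g).trans ((congrArg obj e).trans (tgt_arr h).symm))

/-- Equivalences of Lie groupoids: `(g, x) ↦ tgt g` is a surjective submersion from
`Y.Arr ×_{Y.Obj} X.Obj` onto `Y.Obj` (essential surjectivity), and `X.Arr` is the fibred product
of `Y.Arr` and `X.Obj × X.Obj` over `Y.Obj × Y.Obj` (full faithfulness). -/
def Hom.IsEquivalence {X Y : DiffGroupoid.{u}} (F : Hom X Y) : Prop :=
  (Function.Surjective (fun p : {p : Y.Arr × X.Obj // Y.src p.1 = F.obj p.2} ↦ Y.tgt p.1.1) ∧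
    IsSubmersion (fun p : {p : Y.Arr × X.Obj // Y.src p.1 = F.obj p.2} ↦ Y.tgt p.1.1)) ∧
  IsDiffeo (fun g : X.Arr ↦
    (⟨(F.arr g, (X.src g, X.tgt g)), F.src_arr g, F.tgt_arr g⟩ :
      {p : Y.Arr × (X.Obj × X.Obj) // Y.src p.1 = F.obj p.2.1 ∧ Y.tgt p.1 = F.obj p.2.2}))

/-- Morita equivalence of Lie groupoids: there are equivalences `X ← Z → Y` from a third Lie
groupoid. -/
def MoritaEquiv (X Y : DiffGroupoid.{u}) : Prop :=
  X.IsLie ∧ Y.IsLie ∧ ∃ Z : DiffGroupoid.{u}, Z.IsLie ∧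
    ∃ (F : Hom Z X) (F' : Hom Z Y), F.IsEquivalence ∧ F'.IsEquivalence

/-- Orbifold groupoids: proper étale Lie groupoids. -/
def IsOrbifoldGroupoid (X : DiffGroupoid.{u}) : Prop :=
  X.IsLie ∧ IsLocalDiffeo X.src ∧ IsLocalDiffeo X.tgt ∧
    @IsProperMap X.Arr (X.Obj × X.Obj) dTopology (@instTopologicalSpaceProd _ _ dTopology dTopology)
      (fun g ↦ (X.src g, X.tgt g))

/-- `X` presents an orbifold: it is Morita equivalent to an orbifold groupoid. -/
def PresentsOrbifold (X : DiffGroupoid.{u}) : Prop :=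
  ∃ Y : DiffGroupoid.{u}, Y.IsOrbifoldGroupoid ∧ MoritaEquiv X Y

/-- The product groupoid. -/
def prod (X Y : DiffGroupoid.{u}) : DiffGroupoid.{u} where
  Obj := X.Obj × Y.Obj
  Arr := X.Arr × Y.Arr
  objDiffeology := inferInstance
  arrDiffeology := inferInstance
  src g := (X.src g.1, Y.src g.2)
  tgt g := (X.tgt g.1, Y.tgt g.2)
  one x := (X.one x.1, Y.one x.2)
  inv g := (X.inv g.1, Y.inv g.2)
  comp g h e := (X.comp g.1 h.1 (congrArg Prod.fst e), Y.comp g.2 h.2 (congrArg Prod.snd e))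
  src_one _ := Prod.ext (X.src_one _) (Y.src_one _)
  tgt_one _ := Prod.ext (X.tgt_one _) (Y.tgt_one _)
  src_inv _ := Prod.ext (X.src_inv _) (Y.src_inv _)
  tgt_inv _ := Prod.ext (X.tgt_inv _) (Y.tgt_inv _)
  src_comp _ _ _ := Prod.ext (X.src_comp _ _ _) (Y.src_comp _ _ _)
  tgt_comp _ _ _ := Prod.ext (X.tgt_comp _ _ _) (Y.tgt_comp _ _ _)
  comp_one _ := Prod.ext (X.comp_one _) (Y.comp_one _)
  one_comp _ := Prod.ext (X.one_comp _) (Y.one_comp _)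
  comp_inv _ := Prod.ext (X.comp_inv _) (Y.comp_inv _)
  inv_comp _ := Prod.ext (X.inv_comp _) (Y.inv_comp _)
  assoc _ _ _ _ _ := Prod.ext (X.assoc _ _ _ _ _) (Y.assoc _ _ _ _ _)

end DiffGroupoid

/-- The translation groupoid `X ⋊ K` of an action of `K` on `X`: an arrow `(k, x)` goes from `x`
to `k • x`. -/
def translationGroupoid (X K : Type u) [Group K] [MulAction K X] [DiffeologicalSpace X]
    [DiffeologicalSpace K] : DiffGroupoid.{u} where
  Obj := X
  Arr := K × X
  objDiffeology := inferInstance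
  arrDiffeology := inferInstance
  src g := g.2
  tgt g := g.1 • g.2
  one x := (1, x)
  inv g := (g.1⁻¹, g.1 • g.2)
  comp g h _ := (g.1 * h.1, h.2)
  src_one _ := rfl
  tgt_one x := one_smul K x
  src_inv _ := rfl
  tgt_inv g := inv_smul_smul g.1 g.2
  src_comp _ _ _ := rfl
  tgt_comp g h e := by
    change (g.1 * h.1) • h.2 = g.1 • g.2
    rw [mul_smul, ← (show g.2 = h.1 • h.2 from e)]
  comp_one _ := Prod.ext (mul_one _) rfl
  one_comp _ := Prod.ext (one_mul _) rfl
  comp_inv _ := Prod.ext (mul_inv_cancel _) rfl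
  inv_comp _ := Prod.ext (inv_mul_cancel _) rfl
  assoc _ _ _ _ _ := Prod.ext (mul_assoc _ _ _) rfl

/-- A multiplicative orbifold invariant with values in `R`: a function on a class `dom` of
groupoids presenting orbifolds, closed under Morita equivalence, which is constant on Morita
equivalence classes and multiplicative on products. -/
structure MultiplicativeOrbifoldInvariant (R : Type v) [CommRing R] where
  dom : Set DiffGroupoid.{u}
  presentsOrbifold : ∀ X ∈ dom, X.PresentsOrbifold
  dom_morita : ∀ X ∈ dom, ∀ Y, X.MoritaEquiv Y → Y ∈ dom
  toFun : dom → R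
  map_morita : ∀ X Y : dom, X.1.MoritaEquiv Y.1 → toFun X = toFun Y
  map_prod : ∀ (X Y : dom) (h : X.1.prod Y.1 ∈ dom), toFun ⟨X.1.prod Y.1, h⟩ = toFun X * toFun Y

open Classical in
/-- The value of the invariant on the translation groupoid `X ⋊ K`, with the convention that it is
zero when `X` is empty. (It is also given the value zero where the invariant is not defined.) -/
def MultiplicativeOrbifoldInvariant.value {R : Type v} [CommRing R]
    (φ : MultiplicativeOrbifoldInvariant.{u} R) (X K : Type u) [Group K] [MulAction K X]
    [DiffeologicalSpace X] [DiffeologicalSpace K] : R :=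
  if IsEmpty X then 0
  else if h : translationGroupoid X K ∈ φ.dom then φ.toFun ⟨_, h⟩ else 0

/-! ### Homomorphisms, fixed points, conjugacy classes -/

section FixedPoints

variable {Γ : Type v} {K : Type u} [Group Γ] [Group K]

/-- The fixed point set `X^⟨θ⟩` of (the image of) a homomorphism `θ : Γ → K`. -/
def fixedSet (θ : Γ →* K) (X : Type u) [MulAction K X] : Set X := {x | ∀ γ, θ γ • x = x}

/-- The centralizer `C_K(θ)` of (the image of) `θ : Γ → K`. -/
abbrev homCentralizer (θ : Γ →* K) : Subgroup K := Subgroup.centralizer (Set.range θ)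

/-- `C_K(θ)` acts on `X^⟨θ⟩`. -/
instance centralizerAction (θ : Γ →* K) (X : Type u) [MulAction K X] :
    MulAction (homCentralizer θ) (fixedSet θ X) where
  smul c x := ⟨(c : K) • (x : X), fun γ ↦ by
    have h : θ γ * c = c * θ γ := Subgroup.mem_centralizer_iff.1 c.2 _ ⟨γ, rfl⟩
    rw [← mul_smul, h, mul_smul, x.2 γ]⟩
  one_smul x := Subtype.ext (one_smul K (x : X))
  mul_smul a b x := Subtype.ext (mul_smul (a : K) (b : K) (x : X))

/-- The term `φ(X^⟨θ⟩ ⋊ C_K(θ))`. -/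
def sectorValue {R : Type w} [CommRing R] (φ : MultiplicativeOrbifoldInvariant.{u} R)
    (X : Type u) [MulAction K X] [DiffeologicalSpace X] [DiffeologicalSpace K]
    (θ : Γ →* K) : R :=
  φ.value (fixedSet θ X) (homCentralizer θ)

/-- Conjugacy of homomorphisms `Γ → K`. -/
def homConjSetoid (Γ : Type v) (K : Type u) [Group Γ] [Group K] : Setoid (Γ →* K) where
  r θ θ' := ∃ k : K, ∀ γ, θ' γ = k * θ γ * k⁻¹
  iseqv :=
    { refl := fun θ ↦ ⟨1, fun γ ↦ by simp⟩
      symm := fun ⟨k, h⟩ ↦ ⟨k⁻¹, fun γ ↦ by rw [h]; group⟩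
      trans := fun ⟨k, h⟩ ⟨l, h'⟩ ↦ ⟨l * k, fun γ ↦ by rw [h', h]; group⟩ }

/-- `HOM(Γ, K)/K`. -/
abbrev HomClass (Γ : Type v) (K : Type u) [Group Γ] [Group K] : Type (max u v) :=
  Quotient (homConjSetoid Γ K)

/-- The map `HOM(Γ, K)/K → HOM(Γ, L)/L` given by composition with `f : K → L`. -/
def HomClass.map {L : Type w} [Group L] (f : K →* L) : HomClass Γ K → HomClass Γ L :=
  Quotient.map (fun θ ↦ f.comp θ) fun _ _ ⟨k, h⟩ ↦ ⟨f k, fun γ ↦ by simp [h]⟩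

end FixedPoints

/-! ### Wreath products -/

section Wreath

/-- The wreath product `G(S_n) = Gⁿ ⋊ S_n`, see `wreath_mul`. -/
abbrev WreathProduct (G : Type u) [Group G] (n : ℕ) : Type u :=
  (Fin n → G) ⋊[mulAutArrow] Equiv.Perm (Fin n)

/-- `(g, s) (h, t) = ((g_i h_{s⁻¹(i)})_i, s t)`. -/
theorem wreath_mul {G : Type u} [Group G] {n : ℕ} (a b : WreathProduct G n) :
    a * b = ⟨fun i ↦ a.left i * b.left (a.right⁻¹ i), a.right * b.right⟩ := rfl

/-- `G(S_n)` is the product of `Gⁿ` and the discrete set `S_n`. -/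
instance wreathDiffeology (G : Type u) [Group G] (n : ℕ) [DiffeologicalSpace G] :
    DiffeologicalSpace (WreathProduct G n) :=
  letI := discreteDiffeology (Equiv.Perm (Fin n))
  induced (fun a : WreathProduct G n ↦ (a.left, a.right))

/-- `(g, s) x = (g_i x_{s⁻¹(i)})_i`. -/
instance wreathAction (G : Type u) [Group G] (n : ℕ) (M : Type u) [MulAction G M] :
    MulAction (WreathProduct G n) (Fin n → M) where
  smul a x := fun i ↦ a.left i • x (a.right⁻¹ i)
  one_smul _ := funext fun _ ↦ one_smul G _
  mul_smul a b _ := funext fun i ↦ mul_smul (a.left i) (b.left (a.right⁻¹ i)) _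

/-- `σ : Γ → S_n` belongs to the isomorphism class of the `Γ`-set `Γ/H`: the set `{1, …, n}` with
`Γ` acting through `σ` is isomorphic to `Γ/H`. -/
def IsCosetRep {Γ : Type u} [Group Γ] (H : Subgroup Γ) {n : ℕ} (σ : Γ →* Equiv.Perm (Fin n)) :
    Prop :=
  ∃ e : Fin n ≃ Γ ⧸ H, ∀ γ i, e (σ γ i) = γ • e i

/-- The class `(Γ/H)`, as a subset of `HOM(Γ, S_n)/S_n` (it has at most one element). -/
def cosetClass {Γ : Type u} [Group Γ] (H : Subgroup Γ) (n : ℕ) :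
    Set (HomClass Γ (Equiv.Perm (Fin n))) :=
  {c | ∃ σ : Γ →* Equiv.Perm (Fin n), IsCosetRep H σ ∧ c = Quotient.mk _ σ}

/-- `π : HOM(Γ, G(S_n))/G(S_n) → HOM(Γ, S_n)/S_n`, composition with `G(S_n) → S_n`. -/
def wreathProj (Γ : Type u) [Group Γ] (G : Type u) [Group G] (n : ℕ) :
    HomClass Γ (WreathProduct G n) → HomClass Γ (Equiv.Perm (Fin n)) :=
  HomClass.map SemidirectProduct.rightHom

end Wreath

/-! ### The bundle `P_ρ = Γ ×_ρ G` and its automorphism group -/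

section BundleSection

variable {Γ G : Type u} [Group Γ] [Group G] {H : Subgroup Γ}

/-- `(γ h, g) ∼ (γ, ρ(h) g)` for `h ∈ H`. -/
def bundleSetoid (ρ : H →* G) : Setoid (Γ × G) where
  r a b := ∃ h : H, b.1 = a.1 * h ∧ a.2 = ρ h * b.2
  iseqv :=
    { refl := fun a ↦ ⟨1, by simp, by simp⟩
      symm := fun ⟨h, h1, h2⟩ ↦ ⟨h⁻¹, by simp [h1], by simp [h2]⟩
      trans := fun ⟨h, h1, h2⟩ ⟨k, k1, k2⟩ ↦
        ⟨h * k, by simp [h1, k1, mul_assoc], by simp [h2, k2, mul_assoc]⟩ }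

/-- The total space of the `Γ`-`G`-principal bundle `P_ρ = Γ ×_ρ G → Γ/H`. -/
def PrincipalBundle (ρ : H →* G) : Type u := Quotient (bundleSetoid ρ)

namespace PrincipalBundle

variable (ρ : H →* G)

/-- The class of `(γ, g)` in `P_ρ`. -/
def mk (γ : Γ) (g : G) : PrincipalBundle ρ := Quotient.mk (bundleSetoid ρ) (γ, g)

variable {ρ}

/-- The bundle projection `[γ, g] ↦ γ H`. -/
def proj : PrincipalBundle ρ → Γ ⧸ H :=
  Quotient.lift (fun a ↦ (a.1 : Γ ⧸ H)) fun a b ⟨h, h1, _⟩ ↦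
    QuotientGroup.eq.2 (by rw [h1, inv_mul_cancel_left]; exact h.2)

/-- The left action of `Γ`: `γ' [γ, g] = [γ' γ, g]`. -/
def leftMul (γ' : Γ) : PrincipalBundle ρ → PrincipalBundle ρ :=
  Quotient.map (fun a ↦ (γ' * a.1, a.2)) fun _ _ ⟨h, h1, h2⟩ ↦ ⟨h, by simp [h1, mul_assoc], h2⟩

/-- The right action of `G`: `[γ, g] g' = [γ, g g']`. -/
def rightMul (g' : G) : PrincipalBundle ρ → PrincipalBundle ρ :=
  Quotient.map (fun a ↦ (a.1, a.2 * g')) fun _ _ ⟨h, h1, h2⟩ ↦ ⟨h, h1, by simp [h2, mul_assoc]⟩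

/-- The quotient diffeology, where `Γ` is discrete. -/
instance diffeology [DiffeologicalSpace G] : DiffeologicalSpace (PrincipalBundle ρ) :=
  letI := discreteDiffeology Γ
  coinduced (fun a : Γ × G ↦ mk ρ a.1 a.2)

theorem eq_mul (p : PrincipalBundle ρ) : ∃ γ g, p = leftMul γ (rightMul g (mk ρ 1 1)) := by
  induction p using Quotient.inductionOn with
  | h a => exact ⟨a.1, a.2, congrArg (Quotient.mk _) (Prod.ext (by simp) (by simp))⟩

theorem leftMul_coe_mk_one (h : H) :
    leftMul (h : Γ) (mk ρ 1 1) = rightMul (ρ h) (mk ρ 1 1) :=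
  Quotient.sound ⟨h⁻¹, by simp, by simp⟩

end PrincipalBundle

/-- The automorphism group of the `Γ`-`G`-principal bundle `P_ρ`: smooth bijections with smooth
inverse commuting with the left action of `Γ` and the right action of `G`. (The induced map on
the base `Γ/H` is determined by `G`-equivariance.) -/
def bundleAut [DiffeologicalSpace G] (ρ : H →* G) : Subgroup (Equiv.Perm (PrincipalBundle ρ)) where
  carrier := {α | DSmooth α ∧ DSmooth α.symm ∧ (∀ γ p, α (p.leftMul γ) = (α p).leftMul γ) ∧
    ∀ g p, α (p.rightMul g) = (α p).rightMul g}
  one_mem' := ⟨dSmooth_id, dSmooth_id, fun _ _ ↦ rfl, fun _ _ ↦ rfl⟩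
  mul_mem' {α β} := fun ⟨a1, a2, a3, a4⟩ ⟨b1, b2, b3, b4⟩ ↦
    ⟨a1.comp b1, b2.comp a2, fun γ p ↦ by simp [b3, a3], fun g p ↦ by simp [b4, a4]⟩
  inv_mem' {α} := fun ⟨a1, a2, a3, a4⟩ ↦
    ⟨a2, a1, fun γ p ↦ α.injective (by simp [a3]), fun g p ↦ α.injective (by simp [a4])⟩

section Aut

variable {ρ : H →* G} {M : Type u} [MulAction G M]

/-- The `Γ`-invariant map `P_ρ → M`, `[γ, g] ↦ g⁻¹ x`, defined by a point `x` of `M^⟨ρ⟩`. Thus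
`M^⟨ρ⟩` is identified with the `Γ`-invariant sections of `P_ρ ×_G M`. -/
def sectionOf (x : fixedSet ρ M) : PrincipalBundle ρ → M :=
  Quotient.lift (fun a ↦ a.2⁻¹ • (x : M)) fun a b ⟨h, _, h2⟩ ↦ by
    have hx : (ρ h)⁻¹ • (x : M) = x := inv_smul_eq_iff.2 (x.2 h).symm
    simp only [h2, mul_inv_rev, mul_smul, hx]

theorem sectionOf_leftMul (x : fixedSet ρ M) (γ : Γ) (p : PrincipalBundle ρ) :
    sectionOf x (p.leftMul γ) = sectionOf x p := by
  induction p using Quotient.inductionOn with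
  | h a => rfl

theorem sectionOf_rightMul (x : fixedSet ρ M) (g : G) (p : PrincipalBundle ρ) :
    sectionOf x (p.rightMul g) = g⁻¹ • sectionOf x p := by
  induction p using Quotient.inductionOn with
  | h a => simp [sectionOf, PrincipalBundle.rightMul, mul_smul]

variable [DiffeologicalSpace G]

/-- The smooth structure of the automorphism group: `α` and `α⁻¹` depend smoothly on the
parameter in the functional diffeology. -/
instance bundleAutDiffeology : DiffeologicalSpace (bundleAut ρ) :=
  functionalDiffeology (fun (α : bundleAut ρ) p ↦ (α : Equiv.Perm (PrincipalBundle ρ)) p)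
      (fun α ↦ α.2.1) ⊓
    functionalDiffeology (fun (α : bundleAut ρ) p ↦ (α : Equiv.Perm (PrincipalBundle ρ)).symm p)
      (fun α ↦ α.2.2.1)

theorem sectionOf_mem (x : fixedSet ρ M) (α : bundleAut ρ) :
    sectionOf x ((α : Equiv.Perm (PrincipalBundle ρ)) (PrincipalBundle.mk ρ 1 1)) ∈
      fixedSet ρ M := fun h ↦ by
  have h1 := sectionOf_leftMul x (h : Γ)
    ((α : Equiv.Perm (PrincipalBundle ρ)) (PrincipalBundle.mk ρ 1 1))
  rw [← α.2.2.2.1, PrincipalBundle.leftMul_coe_mk_one, α.2.2.2.2, sectionOf_rightMul] at h1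
  exact (inv_smul_eq_iff.1 h1).symm

/-- The automorphism group of `P_ρ` acts on `M^⟨ρ⟩`, i.e. on invariant sections, by
`x ↦ x ∘ α⁻¹`. Concretely, if `(u, g) ∈ N_Γ(H) × G` stabilizes `ρ`, then the automorphism
`[γ, k] ↦ [γ u⁻¹, g k]` acts by `x ↦ g x`, see `bundleAut_smul_eq`. -/
instance bundleAutAction : MulAction (bundleAut ρ) (fixedSet ρ M) where
  smul α x := ⟨sectionOf x (((α⁻¹ : bundleAut ρ) : Equiv.Perm (PrincipalBundle ρ))
    (PrincipalBundle.mk ρ 1 1)), sectionOf_mem x α⁻¹⟩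
  one_smul x := Subtype.ext (show (1 : G)⁻¹ • (x : M) = x by simp)
  mul_smul α β x := Subtype.ext <| by
    set y : fixedSet ρ M := ⟨sectionOf x (((β⁻¹ : bundleAut ρ) : Equiv.Perm (PrincipalBundle ρ))
      (PrincipalBundle.mk ρ 1 1)), sectionOf_mem x β⁻¹⟩ with hy
    have key : ∀ p, sectionOf y p =
        sectionOf x (((β⁻¹ : bundleAut ρ) : Equiv.Perm (PrincipalBundle ρ)) p) := fun p ↦ by
      obtain ⟨γ, g, rfl⟩ := p.eq_mul
      rw [sectionOf_leftMul, sectionOf_rightMul, (β⁻¹).2.2.2.1, (β⁻¹).2.2.2.2,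
        sectionOf_leftMul, sectionOf_rightMul]
      exact congrArg _ (show (1 : G)⁻¹ • (y : M) = _ by simp [hy])
    change sectionOf x ((((α * β)⁻¹ : bundleAut ρ) : Equiv.Perm (PrincipalBundle ρ))
        (PrincipalBundle.mk ρ 1 1)) =
      sectionOf y (((α⁻¹ : bundleAut ρ) : Equiv.Perm (PrincipalBundle ρ)) (PrincipalBundle.mk ρ 1 1))
    rw [key, mul_inv_rev]
    rfl

theorem bundleAut_smul_eq (α : bundleAut ρ) (u : Γ) (g : G)
    (h : ∀ γ k, (α : Equiv.Perm (PrincipalBundle ρ)) (PrincipalBundle.mk ρ γ k) =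
      PrincipalBundle.mk ρ (γ * u⁻¹) (g * k))
    (x : fixedSet ρ M) : ((α • x : fixedSet ρ M) : M) = g • (x : M) := by
  have h1 : (α : Equiv.Perm (PrincipalBundle ρ)).symm (PrincipalBundle.mk ρ 1 1) =
      PrincipalBundle.mk ρ u g⁻¹ := by
    rw [Equiv.symm_apply_eq, h]; simp
  change sectionOf x ((α : Equiv.Perm (PrincipalBundle ρ)).symm (PrincipalBundle.mk ρ 1 1)) = _
  rw [h1]
  change (g⁻¹)⁻¹ • (x : M) = _
  rw [inv_inv]

end Aut

end BundleSection

/-! ### The `(Γ/H)`-extension -/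

section Extension

variable {Γ : Type u} [Group Γ] (H : Subgroup Γ) (G : Type u) [Group G]

/-- The action of `N_Γ(H) × G` on `HOM(H, G)`: `(ρ (u, g))(h) = g⁻¹ ρ(u h u⁻¹) g`. -/
def normalizerAct {H : Subgroup Γ} {G : Type u} [Group G] (ρ : H →* G)
    (u : Subgroup.normalizer (H : Set Γ)) (g : G) : H →* G where
  toFun h := g⁻¹ * ρ ⟨u * h * (u : Γ)⁻¹, (Subgroup.mem_normalizer_iff.1 u.2 h).1 h.2⟩ * g
  map_one' := by
    have : (⟨u * (1 : H) * (u : Γ)⁻¹, (Subgroup.mem_normalizer_iff.1 u.2 (1 : H)).1 (1 : H).2⟩ : H)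
        = 1 := Subtype.ext (by simp)
    rw [this]; simp
  map_mul' a b := by
    have : (⟨u * (a * b : H) * (u : Γ)⁻¹,
          (Subgroup.mem_normalizer_iff.1 u.2 (a * b : H)).1 (a * b : H).2⟩ : H)
        = ⟨u * a * (u : Γ)⁻¹, (Subgroup.mem_normalizer_iff.1 u.2 a).1 a.2⟩ *
          ⟨u * b * (u : Γ)⁻¹, (Subgroup.mem_normalizer_iff.1 u.2 b).1 b.2⟩ :=
      Subtype.ext (by simp)
    rw [this, map_mul]; group

/-- The orbit relation of the action of `N_Γ(H) × G` on `HOM(H, G)`. -/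
def normalizerSetoid : Setoid (H →* G) where
  r ρ ρ' := ∃ u g, ρ' = normalizerAct ρ u g
  iseqv :=
    { refl := fun ρ ↦ ⟨1, 1, by ext h; simp [normalizerAct]⟩
      symm := by
        rintro ρ _ ⟨u, g, rfl⟩
        exact ⟨u⁻¹, g⁻¹, by ext h; simp [normalizerAct, mul_assoc]⟩
      trans := by
        rintro ρ _ _ ⟨u, g, rfl⟩ ⟨u', g', rfl⟩
        exact ⟨u * u', g * g', by ext h; simp [normalizerAct, mul_assoc]⟩ }

/-- `HOM(H, G)/(N_Γ(H) × G)`. -/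
abbrev NormalizerClass : Type u := Quotient (normalizerSetoid H G)

variable {G} (M : Type u) [MulAction G M] [DiffeologicalSpace G] [DiffeologicalSpace M]
  {R : Type v} [CommRing R]

/-- The term `φ(M^⟨ρ⟩ ⋊ Aut(P_ρ))`. -/
def bundleValue {H : Subgroup Γ} (φ : MultiplicativeOrbifoldInvariant.{u} R) (ρ : H →* G) : R :=
  φ.value (fixedSet ρ M) (bundleAut ρ)

variable (G) in
/-- The `(Γ/H)`-extension `φ_{(Γ/H)}(M ⋊ G) = ∑_{[ρ]} φ(M^⟨ρ⟩ ⋊ Aut(P_ρ))`, one representative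
`ρ` being chosen in each `N_Γ(H) × G`-orbit. -/
def cosetExtension (φ : MultiplicativeOrbifoldInvariant.{u} R) : R :=
  ∑ᶠ c : NormalizerClass H G, bundleValue M φ c.out

end Extension

end OrbifoldExtension

end

open OrbifoldExtension

/-! Both sums run over isomorphism classes of the same objects: principal `G`-bundles with commuting
`Γ`-action over a base isomorphic to `Γ/H`. The wreath product `G(S_n)` is the automorphism group of
the trivial bundle `{1, …, n} × G` (`wreathPerm_injective`, `exists_wreathPerm_eq`), so a
homomorphism `τ` is a `Γ`-action on that bundle, and `π` remembers the action on the base. For a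
base of type `Γ/H`, a point `(i₀, g₀)` over an element with stabilizer `H` turns the action of `H`
on its fibre into a homomorphism `ρ`, and identifies `P_ρ` with the trivial bundle; `IsFraming`
records this situation.

Two trivialisations of one `P_ρ` differ by an element of `G(S_n)`, which gives conjugacy of `τ`
(`IsFraming.conj`). Two base points for one `τ` differ by elements of `N_Γ(H)` and `G`, which gives
the orbit relation on `ρ` (`IsFraming.normalizer`, `IsFraming.translate`). Hence the index sets
correspond (`exists_bijOn_isFraming`). Under a framing, bundle automorphisms become permutations by
elements of `C(τ)`, and invariant sections become `τ`-fixed points of `Mⁿ`. Both identifications are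
diffeomorphisms and are compatible with the actions, so the translation groupoids are isomorphic,
hence Morita equivalent when they lie in the domain of `φ`, and the terms agree
(`IsFraming.bundleValue_eq`).

Finiteness is a statement about isotropy. A point fixed by `ρ(H)` puts `ρ(H)` inside its isotropy
group, which is finite. Isotropy groups of points near `x` are conjugate into that of `x`
(`eventually_stabilizer_conj`): they are close to it, Lie groups have no small subgroups, and
homomorphisms from finite groups are rigid (`eventually_conj`). By compactness of `M`, every such
`ρ` is conjugate to a homomorphism into one of finitely many finite groups; since `H` is finitely
generated, only finitely many occur. -/

namespace OrbifoldExtension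
open Diffeology

/-! ### Transport of smooth structure along diffeomorphisms. -/

section Diffeos

variable {X : Type u} {Y : Type v} [DiffeologicalSpace X] [DiffeologicalSpace Y]

/-- The homeomorphism of D-topologies underlying a diffeomorphism. -/
def dHomeomorph (e : X ≃ Y) (h : DSmooth e) (h' : DSmooth e.symm) :
    @Homeomorph X Y dTopology dTopology :=
  letI : TopologicalSpace X := dTopology
  letI : TopologicalSpace Y := dTopology
  { e with
    continuous_toFun := h.continuous
    continuous_invFun := h'.continuous }

theorem isPlot_subtype_iff {P : X → Prop} {n : ℕ} {p : EuclideanSpace ℝ (Fin n) → Subtype P} :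
    IsPlot p ↔ IsPlot (fun r ↦ (p r : X)) := Iff.rfl

theorem dSmooth_subtype_val {P : X → Prop} : DSmooth (Subtype.val : Subtype P → X) :=
  fun _ _ hp ↦ hp

theorem dSmooth_subtype_iff {P : Y → Prop} {f : X → Subtype P} :
    DSmooth f ↔ DSmooth (fun x ↦ (f x : Y)) := Iff.rfl

theorem dSmooth_fst : DSmooth (Prod.fst : X × Y → X) := fun _ _ hp ↦ (isPlot_prod_iff.1 hp).1

theorem dSmooth_snd : DSmooth (Prod.snd : X × Y → Y) := fun _ _ hp ↦ (isPlot_prod_iff.1 hp).2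

theorem _root_.Diffeology.DSmooth.prodMk {Z : Type w} [DiffeologicalSpace Z] {f : Z → X} {g : Z → Y}
    (hf : DSmooth f) (hg : DSmooth g) : DSmooth (fun z ↦ (f z, g z)) :=
  fun _ _ hp ↦ isPlot_prod_iff.2 ⟨hf _ _ hp, hg _ _ hp⟩

theorem isPlot_pi_iff {ι : Type u} {X : ι → Type v} [∀ i, DiffeologicalSpace (X i)] {n : ℕ}
    {p : EuclideanSpace ℝ (Fin n) → ∀ i, X i} : IsPlot p ↔ ∀ i, IsPlot (fun r ↦ p r i) :=
  DiffeologicalSpace.isPlot_iInf_iff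

theorem IsSmoothManifold.of_diffeo (e : X ≃ Y) (h : DSmooth e) (h' : DSmooth e.symm)
    (hX : IsSmoothManifold X) : IsSmoothManifold Y := by
  obtain ⟨h1, h2, h3⟩ := hX
  refine ⟨?_, ?_, fun y ↦ ?_⟩
  · let _ : TopologicalSpace X := dTopology
    let _ : TopologicalSpace Y := dTopology
    exact (dHomeomorph e h h').t2Space
  · let _ : TopologicalSpace X := dTopology
    let _ : TopologicalSpace Y := dTopology
    exact (dHomeomorph e h h').symm.secondCountableTopology
  · obtain ⟨U, hU, hx, n, f, e', rfl, he, he'⟩ := h3 (e.symm y)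
    refine ⟨e.symm ⁻¹' U, ?_, hx, n, _, ⟨(e.symm.subtypeEquiv fun _ ↦ Iff.rfl).trans e', rfl, ?_, ?_⟩⟩
    · exact @IsOpen.preimage _ _ dTopology dTopology _ h'.continuous _ hU
    · exact he.comp (dSmooth_subtype_iff.2 (h'.comp dSmooth_subtype_val))
    · exact dSmooth_subtype_iff.2 (h.comp (dSmooth_subtype_val.comp he'))

end Diffeos

theorem IsSubmersion.of_diffeo {X X' Y Y' : Type u} [DiffeologicalSpace X] [DiffeologicalSpace X']
    [DiffeologicalSpace Y] [DiffeologicalSpace Y'] {f : X → Y} {f' : X' → Y'}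
    (e : X ≃ X') (he : DSmooth e) (he' : DSmooth e.symm)
    (d : Y ≃ Y') (hd : DSmooth d) (hd' : DSmooth d.symm)
    (hc : ∀ x, f' (e x) = d (f x)) (hf : IsSubmersion f) : IsSubmersion f' := by
  have hc' : ∀ x, f' x = d (f (e.symm x)) := fun x ↦ by rw [← hc, e.apply_symm_apply]
  refine ⟨?_, fun x ↦ ?_⟩
  · rw [show f' = d ∘ f ∘ e.symm from funext hc']
    exact hd.comp (hf.1.comp he')
  · obtain ⟨V, hV, hx, σ, hσ, hs, hσx⟩ := hf.2 (e.symm x)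
    refine ⟨d.symm ⁻¹' V, @IsOpen.preimage _ _ dTopology dTopology _ hd'.continuous _ hV, ?_,
      fun y ↦ e (σ ⟨d.symm y, y.2⟩), ?_, ?_, ?_⟩
    · simpa [hc'] using hx
    · exact he.comp (hσ.comp (dSmooth_subtype_iff.2 (hd'.comp dSmooth_subtype_val)))
    · intro y
      rw [hc, hs]; simp
    · have : (⟨d.symm (f' x), by simpa [hc'] using hx⟩ : V) = ⟨f (e.symm x), hx⟩ :=
        Subtype.ext (by simp [hc'])
      simp only [this, hσx, e.apply_symm_apply]

/-! ### Isomorphic Lie groupoids are Morita equivalent. -/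

namespace DiffGroupoid

/-- An isomorphism of groupoids which is a diffeomorphism on objects and on arrows. -/
structure Iso (X Y : DiffGroupoid.{u}) extends Hom X Y where
  objEquiv : X.Obj ≃ Y.Obj
  arrEquiv : X.Arr ≃ Y.Arr
  coe_objEquiv : ∀ x, objEquiv x = obj x
  coe_arrEquiv : ∀ x, arrEquiv x = arr x
  smooth_objEquiv_symm : DSmooth objEquiv.symm
  smooth_arrEquiv_symm : DSmooth arrEquiv.symm

namespace Iso

variable {X Y : DiffGroupoid.{u}} (F : Iso X Y)

/-- The identity isomorphism. -/
def refl (X : DiffGroupoid.{u}) : Iso X X where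
  obj := id
  arr := id
  smooth_obj := dSmooth_id
  smooth_arr := dSmooth_id
  src_arr _ := rfl
  tgt_arr _ := rfl
  map_one _ := rfl
  map_comp _ _ _ := rfl
  objEquiv := Equiv.refl _
  arrEquiv := Equiv.refl _
  coe_objEquiv _ := rfl
  coe_arrEquiv _ := rfl
  smooth_objEquiv_symm := dSmooth_id
  smooth_arrEquiv_symm := dSmooth_id

include F

theorem smooth_objEquiv : DSmooth F.objEquiv := by
  rw [funext F.coe_objEquiv]; exact F.smooth_obj

theorem smooth_arrEquiv : DSmooth F.arrEquiv := by
  rw [funext F.coe_arrEquiv]; exact F.smooth_arr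

theorem src_arrEquiv_symm (g : Y.Arr) : X.src (F.arrEquiv.symm g) = F.objEquiv.symm (Y.src g) := by
  rw [Equiv.eq_symm_apply, F.coe_objEquiv, ← F.src_arr, ← F.coe_arrEquiv, Equiv.apply_symm_apply]

theorem tgt_arrEquiv_symm (g : Y.Arr) : X.tgt (F.arrEquiv.symm g) = F.objEquiv.symm (Y.tgt g) := by
  rw [Equiv.eq_symm_apply, F.coe_objEquiv, ← F.tgt_arr, ← F.coe_arrEquiv, Equiv.apply_symm_apply]

theorem arr_inv (g : X.Arr) : F.arr (X.inv g) = Y.inv (F.arr g) := by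
  have h1 := F.map_comp (X.inv g) g (X.src_inv g)
  rw [X.inv_comp, F.map_one] at h1
  have e1 : Y.src (F.arr (X.inv g)) = Y.tgt (F.arr g) := by rw [F.src_arr, X.src_inv, F.tgt_arr]
  have h2 := Y.assoc (F.arr (X.inv g)) (F.arr g) (Y.inv (F.arr g)) e1 (Y.tgt_inv _).symm
  have h3 : ∀ (a b c : Y.Arr) (h : a = c) (e e'), Y.comp a b e = Y.comp c b e' := by
    rintro a b c rfl e e'; rfl
  -- A composite carries a proof of composability, so arguments are exchanged through `h3` and `h4`
  -- instead of by rewriting. Bracketing `F(g⁻¹) F(g) F(g)⁻¹` in two ways then gives the claim.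
  have h4 : ∀ (a b c : Y.Arr) (h : b = c) (e e'), Y.comp a b e = Y.comp a c e' := by
    rintro a b c rfl e e'; rfl
  rw [h4 _ _ _ (Y.comp_inv (F.arr g)) _ (e1.trans (Y.tgt_one _).symm),
    h4 _ _ _ (congrArg Y.one e1.symm) _ (Y.tgt_one _).symm, Y.comp_one,
    h3 _ _ _ h1.symm _ (by rw [Y.src_one, Y.tgt_inv, F.src_arr]),
    h3 _ _ _ (show Y.one (F.obj (X.src g)) = Y.one (Y.tgt (Y.inv (F.arr g))) by
      rw [Y.tgt_inv, F.src_arr]) _ (Y.src_one _), Y.one_comp] at h2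
  exact h2.symm

theorem isLie (hX : X.IsLie) : Y.IsLie := by
  obtain ⟨h1, h2, h3, h4, h5, h6, h7⟩ := hX
  refine ⟨h1.of_diffeo F.objEquiv F.smooth_objEquiv F.smooth_objEquiv_symm,
    h2.of_diffeo F.arrEquiv F.smooth_arrEquiv F.smooth_arrEquiv_symm,
    h3.of_diffeo F.arrEquiv F.smooth_arrEquiv F.smooth_arrEquiv_symm
      F.objEquiv F.smooth_objEquiv F.smooth_objEquiv_symm fun x ↦ ?_,
    h4.of_diffeo F.arrEquiv F.smooth_arrEquiv F.smooth_arrEquiv_symm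
      F.objEquiv F.smooth_objEquiv F.smooth_objEquiv_symm fun x ↦ ?_, ?_, ?_, ?_⟩
  · rw [F.coe_arrEquiv, F.coe_objEquiv, F.src_arr]
  · rw [F.coe_arrEquiv, F.coe_objEquiv, F.tgt_arr]
  · rw [show Y.one = F.arr ∘ X.one ∘ F.objEquiv.symm from funext fun y ↦ by
      simp [F.map_one, ← F.coe_objEquiv]]
    exact F.smooth_arr.comp (h5.comp F.smooth_objEquiv_symm)
  · rw [show Y.inv = F.arr ∘ X.inv ∘ F.arrEquiv.symm from funext fun y ↦ by
      simp [F.arr_inv, ← F.coe_arrEquiv]]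
    exact F.smooth_arr.comp (h6.comp F.smooth_arrEquiv_symm)
  · have hm : ∀ p : {p : Y.Arr × Y.Arr // Y.src p.1 = Y.tgt p.2},
        X.src (F.arrEquiv.symm p.1.1) = X.tgt (F.arrEquiv.symm p.1.2) := fun p ↦ by
      rw [F.src_arrEquiv_symm, F.tgt_arrEquiv_symm, p.2]
    have : (fun p : {p : Y.Arr × Y.Arr // Y.src p.1 = Y.tgt p.2} ↦ Y.comp p.1.1 p.1.2 p.2) =
        F.arr ∘ (fun p : {p : X.Arr × X.Arr // X.src p.1 = X.tgt p.2} ↦ X.comp p.1.1 p.1.2 p.2) ∘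
          fun p ↦ ⟨(F.arrEquiv.symm p.1.1, F.arrEquiv.symm p.1.2), hm p⟩ := by
      funext p
      have h : ∀ (a b c d : Y.Arr) (_ : a = c) (_ : b = d) (e e'),
          Y.comp a b e = Y.comp c d e' := by
        rintro a b c d rfl rfl e e'; rfl
      simp only [Function.comp_apply, F.map_comp]
      exact h _ _ _ _ (by simp [← F.coe_arrEquiv]) (by simp [← F.coe_arrEquiv]) _ _
    rw [this]
    refine F.smooth_arr.comp (h7.comp (dSmooth_subtype_iff.2 (DSmooth.prodMk ?_ ?_)))
    · exact F.smooth_arrEquiv_symm.comp (dSmooth_fst.comp dSmooth_subtype_val)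
    · exact F.smooth_arrEquiv_symm.comp (dSmooth_snd.comp dSmooth_subtype_val)

/-- A local section of the target map of `Y` supplies the arrow, and the isomorphism on objects then
forces the point of `X`. In the fibred product the arrow of `Y` determines both endpoints, so
`arrEquiv.symm` of the first coordinate is a smooth inverse. -/
theorem isEquivalence (hY : Y.IsLie) : F.toHom.IsEquivalence := by
  obtain ⟨h1, h2, h3, h4, h5, h6, h7⟩ := hY
  have hobj : ∀ y, F.obj (F.objEquiv.symm y) = y := fun y ↦ by
    rw [← F.coe_objEquiv, Equiv.apply_symm_apply]
  refine ⟨⟨fun y ↦ ⟨⟨(Y.one y, F.objEquiv.symm y), ?_⟩, Y.tgt_one y⟩, ?_, fun p ↦ ?_⟩, ?_⟩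
  · rw [Y.src_one, hobj]
  · exact h4.1.comp (dSmooth_fst.comp dSmooth_subtype_val)
  · obtain ⟨V, hV, hx, σ, hσ, hs, hσx⟩ := h4.2 p.1.1
    refine ⟨V, hV, hx, fun y ↦ ⟨(σ y, F.objEquiv.symm (Y.src (σ y))), (hobj _).symm⟩, ?_, hs, ?_⟩
    · exact dSmooth_subtype_iff.2 (hσ.prodMk (F.smooth_objEquiv_symm.comp (h3.1.comp hσ)))
    · refine Subtype.ext (Prod.ext hσx ?_)
      simp only [hσx]
      rw [p.2, Equiv.symm_apply_eq, F.coe_objEquiv]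
  · refine ⟨⟨_, fun p ↦ F.arrEquiv.symm p.1.1, fun g ↦ ?_, fun p ↦ ?_⟩, rfl, ?_, ?_⟩
    · simp [← F.coe_arrEquiv]
    · refine Subtype.ext (Prod.ext ?_ (Prod.ext ?_ ?_))
      · simp [← F.coe_arrEquiv]
      · simp only [F.src_arrEquiv_symm, p.2.1, ← F.coe_objEquiv, Equiv.symm_apply_apply]
      · simp only [F.tgt_arrEquiv_symm, p.2.2, ← F.coe_objEquiv, Equiv.symm_apply_apply]
    · refine dSmooth_subtype_iff.2 (F.smooth_arr.prodMk (DSmooth.prodMk ?_ ?_))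
      · rw [show X.src = F.objEquiv.symm ∘ Y.src ∘ F.arrEquiv from funext fun g ↦ by
          simp [← F.src_arrEquiv_symm]]
        exact F.smooth_objEquiv_symm.comp (h3.1.comp F.smooth_arrEquiv)
      · rw [show X.tgt = F.objEquiv.symm ∘ Y.tgt ∘ F.arrEquiv from funext fun g ↦ by
          simp [← F.tgt_arrEquiv_symm]]
        exact F.smooth_objEquiv_symm.comp (h4.1.comp F.smooth_arrEquiv)
    · exact F.smooth_arrEquiv_symm.comp (dSmooth_fst.comp dSmooth_subtype_val)

theorem moritaEquiv (hX : X.IsLie) : X.MoritaEquiv Y :=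
  ⟨hX, F.isLie hX, X, hX, (Iso.refl X).toHom, F.toHom, (Iso.refl X).isEquivalence hX,
    F.isEquivalence (F.isLie hX)⟩

end Iso

end DiffGroupoid

theorem MultiplicativeOrbifoldInvariant.isLie_of_mem {R : Type v} [CommRing R]
    (φ : MultiplicativeOrbifoldInvariant.{u} R) {X : DiffGroupoid.{u}} (hX : X ∈ φ.dom) :
    X.IsLie := by
  obtain ⟨_, _, h⟩ := φ.presentsOrbifold X hX
  exact h.1

/-! ### Invariance of the value under equivariant diffeomorphism. -/

section Value

variable {X K X' K' : Type u} [Group K] [MulAction K X] [DiffeologicalSpace X]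
  [DiffeologicalSpace K] [Group K'] [MulAction K' X'] [DiffeologicalSpace X']
  [DiffeologicalSpace K']

/-- An equivariant pair of diffeomorphisms induces an isomorphism of translation groupoids. -/
def translationIso (e : X ≃ X') (f : K ≃* K') (hef : ∀ k x, e (k • x) = f k • e x)
    (he : DSmooth e) (he' : DSmooth e.symm) (hf : DSmooth f) (hf' : DSmooth f.symm) :
    (translationGroupoid X K).Iso (translationGroupoid X' K') where
  obj := e
  arr g := (f g.1, e g.2)
  smooth_obj := he
  smooth_arr := (hf.comp dSmooth_fst).prodMk (he.comp dSmooth_snd)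
  src_arr _ := rfl
  tgt_arr g := (hef g.1 g.2).symm
  map_one _ := Prod.ext (map_one f) rfl
  map_comp _ _ _ := Prod.ext (map_mul f _ _) rfl
  objEquiv := e
  arrEquiv := f.toEquiv.prodCongr e
  coe_objEquiv _ := rfl
  coe_arrEquiv _ := rfl
  smooth_objEquiv_symm := he'
  smooth_arrEquiv_symm := (hf'.comp dSmooth_fst).prodMk (he'.comp dSmooth_snd)

/-- The isomorphism and its inverse show that the two groupoids lie in the domain of `φ`
simultaneously, so the zero conventions match on both sides. -/
theorem MultiplicativeOrbifoldInvariant.value_congr {R : Type v} [CommRing R]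
    (φ : MultiplicativeOrbifoldInvariant.{u} R)
    (e : X ≃ X') (f : K ≃* K') (hef : ∀ k x, e (k • x) = f k • e x)
    (he : DSmooth e) (he' : DSmooth e.symm) (hf : DSmooth f) (hf' : DSmooth f.symm) :
    φ.value X K = φ.value X' K' := by
  have F := translationIso e f hef he he' hf hf'
  have F' := translationIso e.symm f.symm (fun k x ↦ by
    rw [Equiv.symm_apply_eq, hef]; simp) he' he hf' hf
  have hdom : translationGroupoid X K ∈ φ.dom ↔ translationGroupoid X' K' ∈ φ.dom :=
    ⟨fun h ↦ φ.dom_morita _ h _ (F.moritaEquiv (φ.isLie_of_mem h)),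
      fun h ↦ φ.dom_morita _ h _ (F'.moritaEquiv (φ.isLie_of_mem h))⟩
  unfold value
  rw [e.isEmpty_congr]
  split_ifs with h1 h2 h3 h3
  · rfl
  · exact φ.map_morita ⟨_, h2⟩ ⟨_, h3⟩ (F.moritaEquiv (φ.isLie_of_mem h2))
  · exact absurd (hdom.1 h2) h3
  · exact absurd (hdom.2 h3) h2
  · rfl

end Value

/-! ### The wreath product as the automorphism group of `{1, …, n} × G`. -/

section WreathAct

variable {G : Type u} [Group G] {n : ℕ}

theorem wreath_mul_left (a b : WreathProduct G n) (i : Fin n) :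
    (a * b).left i = a.left i * b.left (a.right⁻¹ i) := rfl

theorem wreath_inv_left (a : WreathProduct G n) (i : Fin n) :
    a⁻¹.left i = (a.left (a.right i))⁻¹ := by
  have h := wreath_mul_left a⁻¹ a i
  rw [inv_mul_cancel] at h
  have h' : a⁻¹.left i * a.left (a.right i) = 1 := by simpa using h.symm
  exact eq_inv_of_mul_eq_one_left h'

/-- The action of `G(S_n)` on the trivial principal bundle `{1, …, n} × G`. -/
def wreathAct (a : WreathProduct G n) (p : Fin n × G) : Fin n × G :=
  (a.right p.1, a.left (a.right p.1) * p.2)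

theorem wreathAct_one (p : Fin n × G) : wreathAct 1 p = p := by
  simp [wreathAct]

theorem wreathAct_mul (a b : WreathProduct G n) (p : Fin n × G) :
    wreathAct (a * b) p = wreathAct a (wreathAct b p) := by
  simp [wreathAct, wreath_mul_left, mul_assoc]

theorem wreathAct_injective : Function.Injective (wreathAct (G := G) (n := n)) := fun a b h ↦ by
  have hr : a.right = b.right := Equiv.ext fun i ↦ congrArg Prod.fst (congrFun h (i, 1))
  refine SemidirectProduct.ext (funext fun i ↦ ?_) hr
  have h1 := congrArg Prod.snd (congrFun h (a.right⁻¹ i, 1))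
  simpa [wreathAct, ← hr] using h1

/-- The action of `G(S_n)` on the trivial principal bundle, by permutations. -/
def wreathPerm : WreathProduct G n →* Equiv.Perm (Fin n × G) where
  toFun a :=
    { toFun := wreathAct a
      invFun := wreathAct a⁻¹
      left_inv := fun p ↦ by rw [← wreathAct_mul, inv_mul_cancel, wreathAct_one]
      right_inv := fun p ↦ by rw [← wreathAct_mul, mul_inv_cancel, wreathAct_one] }
  map_one' := Equiv.ext wreathAct_one
  map_mul' a b := Equiv.ext (wreathAct_mul a b)

theorem wreathPerm_apply (a : WreathProduct G n) (p : Fin n × G) :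
    wreathPerm a p = (a.right p.1, a.left (a.right p.1) * p.2) := rfl

theorem wreathPerm_injective : Function.Injective (wreathPerm (G := G) (n := n)) := fun _ _ h ↦
  wreathAct_injective (congrArg DFunLike.coe h)

/-- Every automorphism of the trivial principal bundle comes from `G(S_n)`. -/
theorem exists_wreathPerm_eq (β : Equiv.Perm (Fin n × G))
    (hβ : ∀ p g, β (p.1, p.2 * g) = ((β p).1, (β p).2 * g)) :
    ∃ a : WreathProduct G n, wreathPerm a = β := by
  have key : ∀ (β : Equiv.Perm (Fin n × G)),
      (∀ p g, β (p.1, p.2 * g) = ((β p).1, (β p).2 * g)) →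
      ∀ p g, β.symm (p.1, p.2 * g) = ((β.symm p).1, (β.symm p).2 * g) := fun β hβ p g ↦ by
    rw [Equiv.symm_apply_eq, hβ, Equiv.apply_symm_apply]
  have hone : ∀ (β : Equiv.Perm (Fin n × G)),
      (∀ p g, β (p.1, p.2 * g) = ((β p).1, (β p).2 * g)) →
      ∀ i, (β.symm ((β (i, 1)).1, 1)).1 = i := fun β hβ i ↦ by
    have := key β hβ (β (i, 1)) (β (i, 1)).2⁻¹
    rw [mul_inv_cancel, Equiv.symm_apply_apply] at this
    rw [this]
  -- The coordinate `left i` acts on the fibre arriving at `i`, so it is read off over the preimage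
  -- of `i`. By `hone` the base maps of `β` and `β⁻¹` are mutually inverse.
  refine ⟨⟨fun i ↦ (β ((β.symm (i, 1)).1, 1)).2,
    ⟨fun i ↦ (β (i, 1)).1, fun i ↦ (β.symm (i, 1)).1, hone β hβ, fun i ↦ hone β.symm (key β hβ) i⟩⟩,
    Equiv.ext fun p ↦ ?_⟩
  have h := hβ (p.1, 1) p.2
  rw [one_mul] at h
  rw [wreathPerm_apply]
  change ((β (p.1, 1)).1, (β ((β.symm ((β (p.1, 1)).1, 1)).1, 1)).2 * p.2) = β p
  rw [hone β hβ]
  exact h.symm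

end WreathAct

/-! ### Framings and the trivialisation of `P_ρ`. -/

section Framing

variable {Γ G : Type u} [Group Γ] [Group G] {H : Subgroup Γ} {n : ℕ}

/-- The point `(i₀, g₀)` of the trivial bundle `{1, …, n} × G`, on which `Γ` acts through `τ`,
defines an isomorphism of `Γ`-`G`-principal bundles from `P_ρ`. -/
structure IsFraming (τ : Γ →* WreathProduct G n) (ρ : H →* G) (i₀ : Fin n) (g₀ : G) : Prop where
  stab : ∀ γ, (τ γ).right i₀ = i₀ ↔ γ ∈ H
  trans : ∀ i, ∃ γ, (τ γ).right i₀ = i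
  left : ∀ h : H, (τ h).left i₀ * g₀ = g₀ * ρ h

namespace IsFraming

variable {τ : Γ →* WreathProduct G n} {ρ : H →* G} {i₀ : Fin n} {g₀ : G}
  (F : IsFraming τ ρ i₀ g₀)

include F

/-- This is the relation `(γ h, g) ∼ (γ, ρ(h) g)` seen in the fibre over `i₀`; it is what makes
`trivFun` well defined. -/
theorem wreathPerm_coe (h : H) (g : G) :
    wreathPerm (τ h) (i₀, g₀ * g) = (i₀, g₀ * (ρ h * g)) := by
  rw [wreathPerm_apply]
  simp only [(F.stab h).2 h.2]
  rw [← mul_assoc, F.left, mul_assoc]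

/-- The map `P_ρ → {1, …, n} × G`, `[γ, g] ↦ τ(γ) (i₀, g₀ g)`. -/
def trivFun : PrincipalBundle ρ → Fin n × G :=
  Quotient.lift (fun a ↦ wreathPerm (τ a.1) (i₀, g₀ * a.2)) fun a b ⟨h, h1, h2⟩ ↦ by
    rw [h1, h2, map_mul, map_mul, Equiv.Perm.mul_apply, F.wreathPerm_coe]

theorem trivFun_mk (γ : Γ) (g : G) :
    F.trivFun (PrincipalBundle.mk ρ γ g) = wreathPerm (τ γ) (i₀, g₀ * g) := rfl

/-- Points with the same image differ by an element of `Γ` fixing `i₀`, hence in `H` by `stab`, and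
then represent the same class. Transitivity reaches every fibre, and `G` acts transitively on each
fibre. -/
theorem trivFun_bijective : Function.Bijective F.trivFun := by
  refine ⟨fun p q hpq ↦ ?_, fun ⟨i, g⟩ ↦ ?_⟩
  · induction p using Quotient.inductionOn with
    | h a =>
    induction q using Quotient.inductionOn with
    | h b =>
    have h1 : wreathPerm (τ a.1) (i₀, g₀ * a.2) = wreathPerm (τ b.1) (i₀, g₀ * b.2) := hpq
    have h2 : (i₀, g₀ * a.2) = wreathPerm (τ (a.1⁻¹ * b.1)) (i₀, g₀ * b.2) := by
      rw [map_mul, map_mul, Equiv.Perm.mul_apply, ← h1, map_inv, map_inv, ← Equiv.Perm.mul_apply,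
        inv_mul_cancel, Equiv.Perm.one_apply]
    have hm : a.1⁻¹ * b.1 ∈ H := (F.stab _).1 (congrArg Prod.fst h2).symm
    have h3 := F.wreathPerm_coe ⟨_, hm⟩ b.2
    rw [← h2] at h3
    exact Quotient.sound ⟨⟨_, hm⟩, by simp, mul_left_cancel (congrArg Prod.snd h3)⟩
  · obtain ⟨γ, rfl⟩ := F.trans i
    refine ⟨PrincipalBundle.mk ρ γ (g₀⁻¹ * ((τ γ).left ((τ γ).right i₀))⁻¹ * g), ?_⟩
    rw [trivFun_mk, wreathPerm_apply]
    simp [mul_assoc]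

/-- The isomorphism `P_ρ ≃ {1, …, n} × G`. -/
noncomputable def triv : PrincipalBundle ρ ≃ Fin n × G := Equiv.ofBijective _ F.trivFun_bijective

theorem triv_mk (γ : Γ) (g : G) :
    F.triv (PrincipalBundle.mk ρ γ g) = wreathPerm (τ γ) (i₀, g₀ * g) := rfl

theorem triv_leftMul (γ : Γ) (p : PrincipalBundle ρ) :
    F.triv (p.leftMul γ) = wreathPerm (τ γ) (F.triv p) := by
  induction p using Quotient.inductionOn with
  | h a =>
    change wreathPerm (τ (γ * a.1)) (i₀, g₀ * a.2) =
      wreathPerm (τ γ) (wreathPerm (τ a.1) (i₀, g₀ * a.2))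
    rw [map_mul, map_mul, Equiv.Perm.mul_apply]

theorem triv_rightMul (g : G) (p : PrincipalBundle ρ) :
    F.triv (p.rightMul g) = ((F.triv p).1, (F.triv p).2 * g) := by
  induction p using Quotient.inductionOn with
  | h a =>
    change wreathPerm (τ a.1) (i₀, g₀ * (a.2 * g)) = _
    rw [show F.triv (Quotient.mk _ a) = wreathPerm (τ a.1) (i₀, g₀ * a.2) from rfl]
    simp [wreathPerm_apply, mul_assoc]

theorem triv_symm_wreathPerm (γ : Γ) (p : Fin n × G) :
    F.triv.symm (wreathPerm (τ γ) p) = (F.triv.symm p).leftMul γ := by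
  rw [Equiv.symm_apply_eq, triv_leftMul, Equiv.apply_symm_apply]

theorem triv_symm_mul (p : Fin n × G) (g : G) :
    F.triv.symm (p.1, p.2 * g) = (F.triv.symm p).rightMul g := by
  rw [Equiv.symm_apply_eq, triv_rightMul, Equiv.apply_symm_apply]

end IsFraming

/-! ### Conjugacy classes of `τ` versus orbits of `ρ`. -/

section Classes

variable {τ τ' : Γ →* WreathProduct G n} {ρ ρ' : H →* G} {i₀ i₀' : Fin n} {g₀ g₀' : G}

/-- Composing one trivialisation of `P_ρ` with the inverse of the other gives a `G`-equivariant
permutation of `{1, …, n} × G`, i.e. an element `k`; that both are `Γ`-equivariant says that `k`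
intertwines `τ` and `τ'`. -/
theorem IsFraming.conj (F : IsFraming τ ρ i₀ g₀) (F' : IsFraming τ' ρ i₀' g₀') :
    ∃ k : WreathProduct G n, ∀ γ, τ' γ = k * τ γ * k⁻¹ := by
  obtain ⟨k, hk⟩ := exists_wreathPerm_eq (F.triv.symm.trans F'.triv) fun p g ↦ by
    simp only [Equiv.trans_apply]
    rw [F.triv_symm_mul, F'.triv_rightMul]
  refine ⟨k, fun γ ↦ eq_mul_inv_of_mul_eq (wreathPerm_injective (Equiv.ext fun p ↦ ?_))⟩
  simp only [map_mul, Equiv.Perm.mul_apply, hk, Equiv.trans_apply, F.triv_symm_wreathPerm,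
    F'.triv_leftMul]

/-- A framing of `τ` translates to a framing of a conjugate of `τ`. -/
theorem IsFraming.map (F : IsFraming τ ρ i₀ g₀) (k : WreathProduct G n)
    (hk : ∀ γ, τ' γ = k * τ γ * k⁻¹) :
    IsFraming τ' ρ (k.right i₀) (k.left (k.right i₀) * g₀) where
  stab γ := by
    rw [← F.stab γ, hk]
    simp
  trans i := by
    obtain ⟨γ, hγ⟩ := F.trans (k.right⁻¹ i)
    exact ⟨γ, by rw [hk]; simp [hγ]⟩
  left h := by
    have h1 : (τ h).right i₀ = i₀ := (F.stab h).2 h.2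
    have h2 : (τ h).right.symm i₀ = i₀ := (Equiv.symm_apply_eq _).2 h1.symm
    rw [hk]
    simp only [wreath_mul_left, wreath_inv_left]
    simp [h2, mul_assoc, F.left h]

/-- Changing the base point of a framing replaces `ρ` by an element of its orbit. -/
theorem IsFraming.translate (F : IsFraming τ ρ i₀ g₀) (u : Subgroup.normalizer (H : Set Γ))
    (g : G) : ∃ i₁ g₁, IsFraming τ (normalizerAct ρ u g) i₁ g₁ := by
  -- The new base point is `τ(u⁻¹)(i₀, g₀)` translated by `g`. Moving `τ(h)` past `τ(u⁻¹)` turns `h`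
  -- into `u h u⁻¹`.
  have hrel : ∀ h : H, ∀ k : G, wreathPerm (τ h) (wreathPerm (τ (u : Γ)⁻¹) (i₀, g₀ * k)) =
      wreathPerm (τ (u : Γ)⁻¹) (i₀, g₀ *
        (ρ ⟨u * h * (u : Γ)⁻¹, (Subgroup.mem_normalizer_iff.1 u.2 h).1 h.2⟩ * k)) := by
    intro h k
    rw [← F.wreathPerm_coe, ← Equiv.Perm.mul_apply, ← Equiv.Perm.mul_apply, ← map_mul, ← map_mul,
      ← map_mul, ← map_mul]
    simp [mul_assoc]
  set q := wreathPerm (τ (u : Γ)⁻¹) (i₀, g₀) with hq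
  have hq1 : q.1 = (τ (u : Γ))⁻¹.right i₀ := by rw [hq, wreathPerm_apply, map_inv]
  refine ⟨q.1, q.2 * g, ⟨fun γ ↦ ?_, fun i ↦ ?_, fun h ↦ ?_⟩⟩
  · rw [Subgroup.mem_normalizer_iff.1 u.2 γ, ← SetLike.mem_coe, SetLike.mem_coe, ← F.stab, hq1]
    simp only [map_mul, SemidirectProduct.mul_right, map_inv, SemidirectProduct.inv_right,
      Equiv.Perm.mul_apply]
    rw [Equiv.Perm.eq_inv_iff_eq]
  · obtain ⟨γ, hγ⟩ := F.trans i
    refine ⟨γ * u, ?_⟩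
    rw [hq1, map_mul]
    simp [hγ]
  · have h1 := hrel h 1
    rw [mul_one, ← hq, mul_one] at h1
    have h2 := congrArg Prod.snd h1
    have h3 := congrArg Prod.fst h1
    simp only [wreathPerm_apply] at h2 h3
    have h4 : (τ (u : Γ)⁻¹).left ((τ (u : Γ)⁻¹).right i₀) * g₀ = q.2 := by
      rw [hq, wreathPerm_apply]
    have h5 : (τ (u : Γ)⁻¹).right i₀ = q.1 := by rw [hq, wreathPerm_apply]
    rw [h5] at h3 h4 h2
    rw [h3] at h2
    change (τ h).left q.1 * (q.2 * g) = q.2 * g * (g⁻¹ * _ * g)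
    rw [← mul_assoc, h2, ← mul_assoc, h4]
    group

/-- An element `v` carrying `i₀` to `i₀'` conjugates one stabilizer into the other. Both are `H`, so
`v` normalizes `H`. -/
theorem IsFraming.normalizer (F : IsFraming τ ρ i₀ g₀) (F' : IsFraming τ ρ' i₀' g₀') :
    ∃ u g, ρ' = normalizerAct ρ u g := by
  obtain ⟨v, hv⟩ := F.trans i₀'
  have hnorm : ∀ h, h ∈ H ↔ v⁻¹ * h * v ∈ H := fun h ↦ by
    rw [← F'.stab, ← F.stab, ← hv]
    simp only [map_mul, SemidirectProduct.mul_right, map_inv, SemidirectProduct.inv_right,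
      Equiv.Perm.mul_apply]
    rw [Equiv.Perm.inv_eq_iff_eq]
  have hu : v⁻¹ ∈ Subgroup.normalizer (H : Set Γ) :=
    Subgroup.mem_normalizer_iff.2 fun h ↦ by simpa using hnorm h
  set c := (τ v).left i₀' with hc
  have hq : ∀ k, wreathPerm (τ v) (i₀, k) = (i₀', c * k) := fun k ↦ by
    rw [wreathPerm_apply]; simp only [hv]; rfl
  -- Since `τ(v)` sends `(i₀, g₀)` to `(i₀', c g₀)`, this is the element of `G` that carries the
  -- image to `(i₀', g₀')`.
  refine ⟨⟨v⁻¹, hu⟩, g₀⁻¹ * c⁻¹ * g₀', MonoidHom.ext fun h ↦ ?_⟩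
  set h' : H := ⟨v⁻¹ * h * v⁻¹⁻¹, (Subgroup.mem_normalizer_iff.1 hu h).1 h.2⟩ with hh'
  change ρ' h = (g₀⁻¹ * c⁻¹ * g₀')⁻¹ * ρ h' * (g₀⁻¹ * c⁻¹ * g₀')
  have e1 := F'.wreathPerm_coe h 1
  have e2 := F.wreathPerm_coe h' (g₀⁻¹ * c⁻¹ * g₀')
  have e3 : wreathPerm (τ h) (wreathPerm (τ v) (i₀, c⁻¹ * g₀')) =
      wreathPerm (τ v) (wreathPerm (τ h') (i₀, c⁻¹ * g₀')) := by
    rw [← Equiv.Perm.mul_apply, ← Equiv.Perm.mul_apply, ← map_mul, ← map_mul, ← map_mul, ← map_mul]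
    congr 3
    simp [hh', mul_assoc]
  rw [show g₀ * (g₀⁻¹ * c⁻¹ * g₀') = c⁻¹ * g₀' by group] at e2
  rw [e2, hq, hq, mul_inv_cancel_left] at e3
  rw [mul_one, mul_one, e3] at e1
  have e4 := congrArg Prod.snd e1
  simp only at e4
  rw [← mul_right_inj g₀', ← e4]
  group

/-- Every `ρ` admits a framing, by the trivialisation of `P_ρ` over `Γ/H`. -/
theorem exists_isFraming_of_hom (hn : n ≠ 0) (hH : H.index = n) (ρ : H →* G) :
    ∃ (τ : Γ →* WreathProduct G n) (i₀ : Fin n) (g₀ : G), IsFraming τ ρ i₀ g₀ := by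
  have hfin : Finite (Γ ⧸ H) := Nat.finite_of_card_ne_zero (by
    rw [← Subgroup.index, hH]; exact hn)
  have e : Fin n ≃ Γ ⧸ H := (Finite.equivFinOfCardEq hH).symm
  let s : Fin n → Γ := fun i ↦ (e i).out
  have hs : ∀ i, (s i : Γ ⧸ H) = e i := fun i ↦ QuotientGroup.out_eq' _
  let σ : Γ →* Equiv.Perm (Fin n) := e.symm.permCongrHom.toMonoidHom.comp (MulAction.toPermHom Γ (Γ ⧸ H))
  have hσ : ∀ γ i, σ γ i = e.symm (γ • e i) := fun γ i ↦ rfl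
  -- The coset section `s` gives the usual induction cocycle: `γ` sends the representative of the
  -- coset `γ⁻¹ i` to that of `i` up to an element of `H`.
  have hmem : ∀ γ i, (s i)⁻¹ * γ * s ((σ γ)⁻¹ i) ∈ H := fun γ i ↦ by
    rw [mul_assoc, ← QuotientGroup.eq, hs]
    rw [← map_inv, ← smul_eq_mul, ← MulAction.Quotient.smul_coe, hs, hσ]
    simp
  let τ : Γ →* WreathProduct G n :=
    { toFun := fun γ ↦ ⟨fun i ↦ ρ ⟨_, hmem γ i⟩, σ γ⟩
      map_one' := by
        refine SemidirectProduct.ext (funext fun i ↦ ?_) (map_one σ)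
        change ρ _ = 1
        rw [← map_one ρ]
        congr 1
        exact Subtype.ext (by simp)
      map_mul' := fun γ γ' ↦ by
        refine SemidirectProduct.ext (funext fun i ↦ ?_) (map_mul σ _ _)
        change ρ _ = ρ _ * ρ _
        rw [← map_mul]
        congr 1
        exact Subtype.ext (by simp [mul_assoc]) }
  let i₀ : Fin n := e.symm ((1 : Γ) : Γ ⧸ H)
  have hs0 : s i₀ ∈ H := by
    have := hs i₀
    rw [Equiv.apply_symm_apply, QuotientGroup.eq, mul_one] at this
    exact inv_mem_iff.1 this
  have hstab : ∀ γ, σ γ i₀ = i₀ ↔ γ ∈ H := fun γ ↦ by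
    rw [hσ, Equiv.apply_symm_apply, Equiv.apply_eq_iff_eq, MulAction.Quotient.smul_coe, eq_comm,
      QuotientGroup.eq]
    simp
  -- The chosen representative `s i₀` of the trivial coset need not be `1`; `g₀` corrects for this.
  refine ⟨τ, i₀, (ρ ⟨_, hs0⟩)⁻¹, hstab, fun i ↦ ⟨s i, ?_⟩, fun h ↦ ?_⟩
  · change σ (s i) i₀ = i
    rw [hσ, Equiv.apply_symm_apply, MulAction.Quotient.smul_coe, smul_eq_mul, mul_one, hs,
      Equiv.symm_apply_apply]
  · change ρ _ * _ = _
    rw [mul_inv_eq_iff_eq_mul, mul_assoc (ρ ⟨s i₀, hs0⟩)⁻¹, eq_inv_mul_iff_mul_eq, ← map_mul, ← map_mul]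
    congr 1
    refine Subtype.ext ?_
    have : (σ h)⁻¹ i₀ = i₀ := by rw [Equiv.Perm.inv_eq_iff_eq, (hstab h).2 h.2]
    change s i₀ * ((s i₀)⁻¹ * h * s ((σ h)⁻¹ i₀)) = h * s i₀
    rw [this]
    group

/-- Let `i₀` correspond to the trivial coset. Its stabilizer is `H`, so `h ↦ (τ h).left i₀` is
multiplicative on `H` and serves as `ρ`, with `g₀ = 1`. The permutation `k` accounts for `τ`
projecting only to a conjugate of `σ`. -/
theorem exists_isFraming_of_mem (τ : Γ →* WreathProduct G n)
    (hτ : Quotient.mk (homConjSetoid Γ (WreathProduct G n)) τ ∈ wreathProj Γ G n ⁻¹' cosetClass H n) :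
    ∃ (ρ : H →* G) (i₀ : Fin n) (g₀ : G), IsFraming τ ρ i₀ g₀ := by
  obtain ⟨σ, ⟨e, he⟩, h⟩ := hτ
  obtain ⟨k, hk⟩ := Quotient.exact h
  have hk' : ∀ γ i, σ γ i = k ((τ γ).right (k⁻¹ i)) := fun γ i ↦ by rw [hk]; rfl
  have hke : ∀ γ i, e (k ((τ γ).right i)) = γ • e (k i) := fun γ i ↦ by rw [← he, hk']; simp
  let i₀ : Fin n := k⁻¹ (e.symm ((1 : Γ) : Γ ⧸ H))
  have hi₀ : e (k i₀) = ((1 : Γ) : Γ ⧸ H) := by simp [i₀]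
  have hstab : ∀ γ, (τ γ).right i₀ = i₀ ↔ γ ∈ H := fun γ ↦ by
    rw [← k.apply_eq_iff_eq, ← e.apply_eq_iff_eq, hke, hi₀, MulAction.Quotient.smul_coe, eq_comm,
      QuotientGroup.eq]
    simp
  have hstab' : ∀ h : H, (τ h).right⁻¹ i₀ = i₀ := fun h ↦ by
    rw [Equiv.Perm.inv_eq_iff_eq, (hstab h).2 h.2]
  refine ⟨{ toFun := fun h ↦ (τ h).left i₀, map_one' := by simp, map_mul' := fun a b ↦ ?_ }, i₀, 1,
    hstab, fun i ↦ ?_, fun h ↦ by simp⟩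
  · rw [Subgroup.coe_mul, map_mul, wreath_mul_left, hstab']
  · obtain ⟨γ, hγ⟩ := QuotientGroup.mk_surjective (e (k i))
    refine ⟨γ, k.injective (e.injective ?_)⟩
    rw [hke, hi₀, MulAction.Quotient.smul_coe, smul_eq_mul, mul_one, hγ]

/-- Orbit-stabilizer: `γ ↦ (τ γ).right i₀` descends to a `Γ`-equivariant bijection from `Γ/H`. -/
theorem IsFraming.mem (F : IsFraming τ ρ i₀ g₀) :
    Quotient.mk (homConjSetoid Γ (WreathProduct G n)) τ ∈ wreathProj Γ G n ⁻¹' cosetClass H n := by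
  refine ⟨SemidirectProduct.rightHom.comp τ, ⟨?_, rfl⟩⟩
  have hinj : ∀ a b : Γ, (τ a).right i₀ = (τ b).right i₀ ↔ (a : Γ ⧸ H) = b := fun a b ↦ by
    rw [QuotientGroup.eq, ← F.stab, map_mul]
    simp only [SemidirectProduct.mul_right, map_inv, SemidirectProduct.inv_right,
      Equiv.Perm.mul_apply]
    rw [Equiv.Perm.inv_eq_iff_eq, eq_comm]
  let f : Γ ⧸ H → Fin n := Quotient.lift (fun γ ↦ (τ γ).right i₀) fun a b h ↦
    (hinj a b).2 (Quotient.sound h)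
  have hf : Function.Bijective f := by
    refine ⟨fun a b h ↦ ?_, fun i ↦ ?_⟩
    · obtain ⟨a, rfl⟩ := QuotientGroup.mk_surjective a
      obtain ⟨b, rfl⟩ := QuotientGroup.mk_surjective b
      exact (hinj a b).1 h
    · obtain ⟨γ, hγ⟩ := F.trans i
      exact ⟨(γ : Γ ⧸ H), hγ⟩
  refine ⟨(Equiv.ofBijective f hf).symm, fun γ i ↦ ?_⟩
  rw [Equiv.symm_apply_eq]
  obtain ⟨a, rfl⟩ := (Equiv.ofBijective f hf).surjective i
  rw [Equiv.symm_apply_apply]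
  obtain ⟨a, rfl⟩ := QuotientGroup.mk_surjective a
  change (τ γ).right ((τ a).right i₀) = (τ (γ * a)).right i₀
  rw [map_mul]; rfl

end Classes

end Framing

/-! ### Plots of discrete spaces and of the wreath product. -/

section Discrete

/-- The plots of the discrete diffeology are constant, as Euclidean spaces are connected. -/
theorem isPlot_discrete_iff {X : Type u} {n : ℕ} {p : EuclideanSpace ℝ (Fin n) → X} :
    @IsPlot X (discreteDiffeology X) n p ↔ ∀ r r', p r = p r' := by
  let d : DiffeologicalSpace X :=
    { plots := fun n ↦ {p | ∀ r r', p r = p r'}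
      constant_plots := fun _ _ _ ↦ rfl
      plot_reparam := fun hp _ _ _ ↦ hp _ _
      locality := fun {n p} hp ↦ by
        have hloc : IsLocallyConstant p := (IsLocallyConstant.iff_exists_open p).2 fun x ↦ by
          obtain ⟨U, hU, hx, h⟩ := hp x
          obtain ⟨ε, hε, hεU⟩ := Metric.isOpen_iff.1 hU x hx
          refine ⟨Metric.ball x ε, Metric.isOpen_ball, Metric.mem_ball_self hε, fun y hy ↦ ?_⟩
          have hball := OpenPartialHomeomorph.univBall_target x hε
          -- Locality tests only maps defined on a whole Euclidean space, so the ball is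
          -- parametrized smoothly by one.
          have h1 := h (f := OpenPartialHomeomorph.univBall x ε) (fun z ↦ hεU (by
            rw [← hball]
            exact (OpenPartialHomeomorph.univBall x ε).map_source (by simp)))
            OpenPartialHomeomorph.contDiff_univBall
          have h2 := h1 ((OpenPartialHomeomorph.univBall x ε).symm y)
            ((OpenPartialHomeomorph.univBall x ε).symm x)
          simp only [Function.comp_apply] at h2
          rwa [OpenPartialHomeomorph.right_inv _ (by rwa [hball]),
            OpenPartialHomeomorph.right_inv _ (by rw [hball]; exact Metric.mem_ball_self hε)] at h2
        exact fun r r' ↦ hloc.apply_eq_of_preconnectedSpace r r' }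
  refine ⟨fun h ↦ DiffeologicalSpace.le_iff'.1 (bot_le : discreteDiffeology X ≤ d) n p h,
    fun h ↦ ?_⟩
  rw [show p = fun _ ↦ p 0 from funext fun r ↦ h r 0]
  exact @isPlot_const _ (discreteDiffeology X) _ _

theorem isPlot_wreath_iff {G : Type u} [Group G] [DiffeologicalSpace G] {n m : ℕ}
    {a : EuclideanSpace ℝ (Fin m) → WreathProduct G n} :
    IsPlot a ↔ (∀ i, IsPlot fun r ↦ (a r).left i) ∧ ∀ r r', (a r).right = (a r').right := by
  let _ := discreteDiffeology (Equiv.Perm (Fin n))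
  refine (isPlot_prod_iff (p := fun r ↦ ((a r).left, (a r).right))).trans ?_
  rw [isPlot_pi_iff, isPlot_discrete_iff]

end Discrete

/-! ### Smoothness of the trivialisation, and automorphisms as centralizers. -/

namespace IsFraming

variable {Γ G : Type u} [Group Γ] [Group G] {H : Subgroup Γ} {n : ℕ} [DiffeologicalSpace G]
  {τ : Γ →* WreathProduct G n} {ρ : H →* G} {i₀ : Fin n} {g₀ : G} (F : IsFraming τ ρ i₀ g₀)

include F

/-- The trivialisation is a diffeomorphism onto `{1, …, n} × G` with discrete base. On generating
plots the `Γ`-coordinate is constant and only left translations of `G` enter; conversely a plot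
lying in one fibre lifts to `Γ × G` with a constant `γ`. -/
theorem isPlot_iff_triv (hmul : ∀ g : G, DSmooth (fun x : G ↦ g * x)) {m : ℕ}
    {q : EuclideanSpace ℝ (Fin m) → PrincipalBundle ρ} :
    IsPlot q ↔ (∀ r r', (F.triv (q r)).1 = (F.triv (q r')).1) ∧
      IsPlot fun r ↦ (F.triv (q r)).2 := by
  let _ := discreteDiffeology (Fin n)
  let _ := discreteDiffeology Γ
  constructor
  · have hle : PrincipalBundle.diffeology (ρ := ρ) ≤ induced F.triv := by
      refine DiffeologicalSpace.generateFrom_le_iff.2 ?_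
      intro m q hq
      obtain ⟨p, hp, rfl⟩ : ∃ p : EuclideanSpace ℝ (Fin m) → Γ × G, IsPlot p ∧
        q = (fun a : Γ × G ↦ PrincipalBundle.mk ρ a.1 a.2) ∘ p := hq
      obtain ⟨hp1, hp2⟩ := isPlot_prod_iff.1 hp
      have hp1' := isPlot_discrete_iff.1 hp1
      have : (F.triv ∘ (fun a : Γ × G ↦ PrincipalBundle.mk ρ a.1 a.2) ∘ p) = fun r ↦
          ((τ (p 0).1).right i₀, (τ (p 0).1).left ((τ (p 0).1).right i₀) * (g₀ * (p r).2)) := by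
        funext r
        simp only [Function.comp_apply, F.triv_mk, wreathPerm_apply]
        rw [hp1' r 0]
      change IsPlot (F.triv ∘ (fun a : Γ × G ↦ PrincipalBundle.mk ρ a.1 a.2) ∘ p)
      rw [this]
      exact isPlot_prod_iff.2 ⟨isPlot_const,
        ((hmul _).comp (hmul _)) _ _ hp2⟩
    intro h
    obtain ⟨h1, h2⟩ := isPlot_prod_iff.1 (DiffeologicalSpace.le_iff'.1 hle _ _ h)
    exact ⟨isPlot_discrete_iff.1 h1, h2⟩
  · rintro ⟨h1, h2⟩
    obtain ⟨γ, hγ⟩ := F.trans (F.triv (q 0)).1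
    refine DiffeologicalSpace.isPlot_generatedFrom_of_mem
      ⟨fun r ↦ (γ, (g₀⁻¹ * ((τ γ).left ((τ γ).right i₀))⁻¹) * (F.triv (q r)).2), ?_, ?_⟩
    · exact isPlot_prod_iff.2 ⟨isPlot_const, hmul _ _ _ h2⟩
    · funext r
      refine F.triv.injective ?_
      simp only [Function.comp_apply]
      rw [F.triv_mk, wreathPerm_apply, hγ]
      exact Prod.ext (h1 _ _) (by simp [mul_assoc])

variable (hmul : DSmooth (fun x : G × G ↦ x.1 * x.2)) (hinv : DSmooth (fun x : G ↦ x⁻¹))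

omit F in
include hmul in
theorem dSmooth_mul_left (g : G) : DSmooth (fun x : G ↦ g * x) :=
  hmul.comp (dSmooth_const.prodMk dSmooth_id)

include hmul

theorem isPlot_wreathPerm {m : ℕ} {a : EuclideanSpace ℝ (Fin m) → WreathProduct G n}
    {q : EuclideanSpace ℝ (Fin m) → PrincipalBundle ρ} (ha : IsPlot a) (hq : IsPlot q) :
    IsPlot fun r ↦ F.triv.symm (wreathPerm (a r) (F.triv (q r))) := by
  obtain ⟨ha1, ha2⟩ := isPlot_wreath_iff.1 ha
  obtain ⟨hq1, hq2⟩ := (F.isPlot_iff_triv (dSmooth_mul_left hmul)).1 hq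
  refine (F.isPlot_iff_triv (dSmooth_mul_left hmul)).2 ?_
  simp only [Equiv.apply_symm_apply, wreathPerm_apply]
  have hc : ∀ r, (a r).right (F.triv (q r)).1 = (a 0).right (F.triv (q 0)).1 := fun r ↦ by
    rw [ha2 r 0, hq1 r 0]
  simp only [hc]
  exact ⟨fun _ _ ↦ trivial, hmul _ (fun r ↦ (_, _)) (isPlot_prod_iff.2 ⟨ha1 _, hq2⟩)⟩

theorem dSmooth_wreathPerm {m : ℕ} {a : EuclideanSpace ℝ (Fin m) → WreathProduct G n}
    (ha : IsPlot a) : DSmooth fun z : EuclideanSpace ℝ (Fin m) × PrincipalBundle ρ ↦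
      F.triv.symm (wreathPerm (a z.1) (F.triv z.2)) := fun _ _ hq ↦
  F.isPlot_wreathPerm hmul (ha.dSmooth _ _ (isPlot_prod_iff.1 hq).1) (isPlot_prod_iff.1 hq).2

theorem dSmooth_wreathPerm_const (a : WreathProduct G n) :
    DSmooth fun p : PrincipalBundle ρ ↦ F.triv.symm (wreathPerm a (F.triv p)) := fun _ _ hq ↦
  F.isPlot_wreathPerm hmul isPlot_const hq

/-- `C(τ)` acts on `P_ρ` by bundle automorphisms. -/
noncomputable def autHom : homCentralizer τ →* bundleAut ρ where
  toFun c := ⟨F.triv.trans ((wreathPerm (c : WreathProduct G n)).trans F.triv.symm),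
    F.dSmooth_wreathPerm_const hmul _, by
      have h := F.dSmooth_wreathPerm_const hmul (c : WreathProduct G n)⁻¹
      rw [map_inv] at h
      exact h, fun γ p ↦ by
      have hc : τ γ * c = c * τ γ := Subgroup.mem_centralizer_iff.1 c.2 _ ⟨γ, rfl⟩
      simp only [Equiv.trans_apply]
      rw [F.triv_leftMul, ← Equiv.Perm.mul_apply, ← map_mul, ← hc, map_mul, Equiv.Perm.mul_apply,
        F.triv_symm_wreathPerm], fun g p ↦ by
      simp only [Equiv.trans_apply]
      rw [F.triv_rightMul, ← F.triv_symm_mul]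
      simp [wreathPerm_apply, mul_assoc]⟩
  map_one' := Subtype.ext (Equiv.ext fun p ↦ by simp)
  map_mul' a b := Subtype.ext (Equiv.ext fun p ↦ by simp)

theorem autHom_apply (c : homCentralizer τ) (p : PrincipalBundle ρ) :
    (F.autHom hmul c : Equiv.Perm (PrincipalBundle ρ)) p =
      F.triv.symm (wreathPerm (c : WreathProduct G n) (F.triv p)) := rfl

theorem autHom_symm_apply (c : homCentralizer τ) (p : PrincipalBundle ρ) :
    (F.autHom hmul c : Equiv.Perm (PrincipalBundle ρ)).symm p =
      F.triv.symm (wreathPerm (c : WreathProduct G n)⁻¹ (F.triv p)) := by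
  rw [map_inv]; rfl

/-- Transported through `triv`, an automorphism is a `G`-equivariant permutation, hence given by
some `a`; commuting with `Γ` means that `a` centralizes `τ`. -/
theorem autHom_bijective : Function.Bijective (F.autHom hmul) := by
  refine ⟨fun c c' h ↦ Subtype.ext (wreathPerm_injective (Equiv.ext fun p ↦ ?_)), fun α ↦ ?_⟩
  · have h1 := F.autHom_apply hmul c (F.triv.symm p)
    rw [h, F.autHom_apply hmul] at h1
    simpa using h1.symm
  · obtain ⟨a, ha⟩ := exists_wreathPerm_eq
      (F.triv.symm.trans ((α : Equiv.Perm (PrincipalBundle ρ)).trans F.triv)) fun p g ↦ by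
        simp only [Equiv.trans_apply]
        rw [F.triv_symm_mul, α.2.2.2.2, F.triv_rightMul]
    refine ⟨⟨a, Subgroup.mem_centralizer_iff.2 ?_⟩, Subtype.ext (Equiv.ext fun p ↦ ?_)⟩
    · rintro _ ⟨γ, rfl⟩
      refine wreathPerm_injective (Equiv.ext fun p ↦ ?_)
      simp only [map_mul, Equiv.Perm.mul_apply, ha, Equiv.trans_apply]
      rw [F.triv_symm_wreathPerm, α.2.2.2.1, F.triv_leftMul]
    · rw [F.autHom_apply hmul]
      simp [ha]

omit F hmul in
theorem isPlot_bundleAut_iff {m : ℕ} {q : EuclideanSpace ℝ (Fin m) → bundleAut ρ} :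
    IsPlot q ↔ DSmooth (fun z : EuclideanSpace ℝ (Fin m) × PrincipalBundle ρ ↦
        (q z.1 : Equiv.Perm (PrincipalBundle ρ)) z.2) ∧
      DSmooth (fun z : EuclideanSpace ℝ (Fin m) × PrincipalBundle ρ ↦
        (q z.1 : Equiv.Perm (PrincipalBundle ρ)).symm z.2) :=
  DiffeologicalSpace.isPlot_inf_iff

include hinv in
-- Evaluating a smooth family at the points `(j, 1)` recovers its wreath coordinates, with constant
-- permutation part. Conversely, the diffeology on automorphisms also asks for smooth inverses,
-- whence the need for `hinv`.
theorem isPlot_autHom_iff {m : ℕ} {a : EuclideanSpace ℝ (Fin m) → homCentralizer τ} :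
    IsPlot (F.autHom hmul ∘ a) ↔ IsPlot a := by
  constructor
  · intro h
    have h1 := (isPlot_bundleAut_iff.1 h).1
    have h2 : ∀ j : Fin n, IsPlot fun r ↦
        F.triv.symm (wreathPerm (a r : WreathProduct G n) (j, 1)) := fun j ↦ by
      have := h1 _ (fun r ↦ (r, F.triv.symm (j, 1))) (isPlot_prod_iff.2 ⟨isPlot_id, isPlot_const⟩)
      simpa only [Function.comp_def, F.autHom_apply hmul, Equiv.apply_symm_apply] using this
    have h3 := fun j ↦ (F.isPlot_iff_triv (dSmooth_mul_left hmul)).1 (h2 j)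
    simp only [Equiv.apply_symm_apply, wreathPerm_apply, mul_one] at h3
    have hr : ∀ r r', (a r : WreathProduct G n).right = (a r' : WreathProduct G n).right :=
      fun r r' ↦ Equiv.ext fun j ↦ (h3 j).1 r r'
    refine isPlot_subtype_iff.2 (isPlot_wreath_iff.2 ⟨fun i ↦ ?_, hr⟩)
    have h4 := (h3 ((a 0 : WreathProduct G n).right⁻¹ i)).2
    simp only [hr _ 0] at h4
    simpa using h4
  · intro h
    have h' : IsPlot fun r ↦ (a r : WreathProduct G n)⁻¹ := by
      obtain ⟨h1, h2⟩ := isPlot_wreath_iff.1 (isPlot_subtype_iff.1 h)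
      refine isPlot_wreath_iff.2 ⟨fun i ↦ ?_, fun r r' ↦ by simp [h2 r r']⟩
      simp only [wreath_inv_left, h2 _ 0]
      exact hinv _ _ (h1 _)
    refine isPlot_bundleAut_iff.2 ⟨F.dSmooth_wreathPerm hmul (isPlot_subtype_iff.1 h), ?_⟩
    simpa only [Function.comp_def, F.autHom_symm_apply hmul] using F.dSmooth_wreathPerm hmul h'

/-! ### Fixed points of `Mⁿ` as invariant sections. -/

variable {M : Type u} [MulAction G M]

omit [DiffeologicalSpace G] hmul F in
theorem wreath_smul_apply (a : WreathProduct G n) (x : Fin n → M) (i : Fin n) :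
    (a • x) i = a.left i • x (a.right⁻¹ i) := rfl

omit [DiffeologicalSpace G] hmul in
theorem right_inv_apply (h : H) : (τ h).right⁻¹ i₀ = i₀ := by
  rw [Equiv.Perm.inv_eq_iff_eq, (F.stab h).2 h.2]

omit [DiffeologicalSpace G] hmul in
theorem restrict_mem {x : Fin n → M} (hx : x ∈ fixedSet τ (Fin n → M)) :
    g₀⁻¹ • x i₀ ∈ fixedSet ρ M := fun h ↦ by
  have h1 := congrFun (hx h) i₀
  rw [wreath_smul_apply, F.right_inv_apply] at h1
  rw [← mul_smul, show ρ h * g₀⁻¹ = g₀⁻¹ * (τ h).left i₀ by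
    rw [mul_inv_eq_iff_eq_mul, mul_assoc, F.left, inv_mul_cancel_left], mul_smul, h1]

omit [DiffeologicalSpace G] hmul in
theorem sectionOf_triv_symm (y : fixedSet ρ M) (p : Fin n × G) (g : G) :
    sectionOf y (F.triv.symm (p.1, p.2 * g)) = g⁻¹ • sectionOf y (F.triv.symm p) := by
  rw [F.triv_symm_mul, sectionOf_rightMul]

omit [DiffeologicalSpace G] hmul in
theorem sectionOf_mem_fixedSet (y : fixedSet ρ M) :
    (fun i ↦ sectionOf y (F.triv.symm (i, 1))) ∈ fixedSet τ (Fin n → M) := fun γ ↦ by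
  funext i
  rw [wreath_smul_apply]
  have h1 := F.triv_symm_wreathPerm γ ((τ γ).right⁻¹ i, 1)
  have h2 := congrArg (sectionOf y) h1
  rw [sectionOf_leftMul, wreathPerm_apply] at h2
  have h3 := F.sectionOf_triv_symm y (i, 1) ((τ γ).left i)
  simp only [one_mul] at h3
  have hi : (τ γ).right ((τ γ).right⁻¹ i) = i := Equiv.apply_symm_apply _ _
  simp only [hi, mul_one] at h2
  rw [← h2, h3, smul_inv_smul]

omit [DiffeologicalSpace G] hmul in
-- A point `x` of `Mⁿ` is the equivariant function `(i, g) ↦ g⁻¹ x_i` on the trivial bundle. Being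
-- fixed by `τ` makes it `Γ`-invariant, so its value at the base point determines it on all of
-- `P_ρ`.
theorem sectionOf_restrict {x : Fin n → M} (hx : x ∈ fixedSet τ (Fin n → M))
    (p : PrincipalBundle ρ) :
    sectionOf ⟨g₀⁻¹ • x i₀, F.restrict_mem hx⟩ p = (F.triv p).2⁻¹ • x (F.triv p).1 := by
  induction p using Quotient.inductionOn with
  | h a =>
    change a.2⁻¹ • g₀⁻¹ • x i₀ = (wreathPerm (τ a.1) (i₀, g₀ * a.2)).2⁻¹ •
      x (wreathPerm (τ a.1) (i₀, g₀ * a.2)).1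
    rw [wreathPerm_apply]
    have h1 := congrFun (hx a.1) ((τ a.1).right i₀)
    rw [wreath_smul_apply] at h1
    have hi : (τ a.1).right⁻¹ ((τ a.1).right i₀) = i₀ := Equiv.symm_apply_apply _ _
    rw [hi] at h1
    simp only [mul_inv_rev, mul_smul]
    rw [← h1, inv_smul_smul]

/-- The identification of `(Mⁿ)^⟨τ⟩` with `M^⟨ρ⟩`. -/
noncomputable def fixedEquiv (M : Type u) [MulAction G M] :
    fixedSet τ (Fin n → M) ≃ fixedSet ρ M where
  toFun x := ⟨g₀⁻¹ • (x : Fin n → M) i₀, F.restrict_mem x.2⟩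
  invFun y := ⟨fun i ↦ sectionOf y (F.triv.symm (i, 1)), F.sectionOf_mem_fixedSet y⟩
  left_inv x := Subtype.ext <| funext fun i ↦ by
    simp only [F.sectionOf_restrict x.2]
    simp
  right_inv y := Subtype.ext <| by
    have h := F.sectionOf_triv_symm y (i₀, 1) g₀
    have h1 : F.triv.symm (i₀, g₀) = PrincipalBundle.mk ρ 1 1 := by
      rw [Equiv.symm_apply_eq, F.triv_mk]
      simp
    simp only [one_mul, h1] at h
    change g₀⁻¹ • sectionOf y (F.triv.symm (i₀, 1)) = y
    rw [← h]
    change (1 : G)⁻¹ • (y : M) = y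
    simp

theorem fixedEquiv_smul (c : homCentralizer τ) (x : fixedSet τ (Fin n → M)) :
    F.fixedEquiv M (c • x) = F.autHom hmul c • F.fixedEquiv M x := Subtype.ext <| by
  change g₀⁻¹ • ((c : WreathProduct G n) • (x : Fin n → M)) i₀ =
    sectionOf ⟨g₀⁻¹ • (x : Fin n → M) i₀, F.restrict_mem x.2⟩
      ((F.autHom hmul c : Equiv.Perm (PrincipalBundle ρ)).symm (PrincipalBundle.mk ρ 1 1))
  rw [F.sectionOf_restrict x.2, F.autHom_symm_apply hmul, Equiv.apply_symm_apply, F.triv_mk,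
    wreath_smul_apply, wreathPerm_apply, wreath_inv_left]
  simp [mul_smul]

theorem bundleValue_eq [DiffeologicalSpace M] {R : Type v} [CommRing R]
    (hinv : DSmooth (fun x : G ↦ x⁻¹)) (hsmul : ∀ g : G, DSmooth (fun x : M ↦ g • x))
    (φ : MultiplicativeOrbifoldInvariant.{u} R) :
    bundleValue M φ ρ = sectorValue φ (Fin n → M) τ := by
  symm
  refine φ.value_congr (F.fixedEquiv M) (MulEquiv.ofBijective _ (F.autHom_bijective hmul))
    (F.fixedEquiv_smul hmul) ?_ ?_ ?_ ?_
  · intro m p hp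
    exact hsmul _ _ _ (isPlot_pi_iff.1 (isPlot_subtype_iff.1 hp) i₀)
  · intro m p hp
    refine isPlot_subtype_iff.2 (isPlot_pi_iff.2 fun i ↦ ?_)
    -- For fixed `i` a representative `(γ, g)` can be chosen once for the whole plot, so the `i`-th
    -- coordinate is translation by the constant `g⁻¹`.
    obtain ⟨⟨γ, g⟩, h⟩ := Quotient.exists_rep (F.triv.symm (i, 1))
    change IsPlot fun r ↦ sectionOf (p r) (F.triv.symm (i, 1))
    rw [← h]
    exact hsmul g⁻¹ _ _ (isPlot_subtype_iff.1 hp)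
  · exact fun m p hp ↦ (F.isPlot_autHom_iff hmul hinv).2 hp
  · intro m p hp
    refine (F.isPlot_autHom_iff hmul hinv).1 ?_
    convert hp
    funext r
    exact (MulEquiv.ofBijective _ (F.autHom_bijective hmul)).apply_symm_apply (p r)

omit [DiffeologicalSpace G] hmul in
theorem nonempty_iff : (fixedSet τ (Fin n → M)).Nonempty ↔ (fixedSet ρ M).Nonempty := by
  rw [← Set.nonempty_coe_sort, ← Set.nonempty_coe_sort, (F.fixedEquiv M).nonempty_congr]

end IsFraming

/-! ### Lie groups near the identity: no small subgroups. -/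

section LieGroups

open Filter

variable {E : Type*} [NormedAddCommGroup E] [NormedSpace ℝ E]
  {G : Type*} [Group G] [TopologicalSpace G] [ChartedSpace E G] [LieGroup 𝓘(ℝ, E) ∞ G]

variable (E G) in
/-- The chart at the identity. -/
noncomputable def oneChart : G → E := extChartAt 𝓘(ℝ, E) (1 : G)

variable (E G) in
/-- The inverse of the chart at the identity. -/
noncomputable def oneChartSymm : E → G := (extChartAt 𝓘(ℝ, E) (1 : G)).symm

omit [LieGroup 𝓘(ℝ, E) ∞ G] in
theorem oneChartSymm_oneChart_one : oneChartSymm E G (oneChart E G 1) = 1 :=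
  extChartAt_to_inv (I := 𝓘(ℝ, E)) (1 : G)

omit [LieGroup 𝓘(ℝ, E) ∞ G] in
theorem eventually_oneChartSymm_oneChart : ∀ᶠ g in 𝓝 (1 : G),
    oneChartSymm E G (oneChart E G g) = g := by
  filter_upwards [extChartAt_source_mem_nhds (I := 𝓘(ℝ, E)) (1 : G)] with g hg
  exact (extChartAt 𝓘(ℝ, E) (1 : G)).left_inv hg

omit [LieGroup 𝓘(ℝ, E) ∞ G] in
theorem eventually_oneChart_oneChartSymm : ∀ᶠ a in 𝓝 (oneChart E G 1),
    oneChart E G (oneChartSymm E G a) = a := by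
  filter_upwards [extChartAt_target_mem_nhds (I := 𝓘(ℝ, E)) (1 : G)] with a ha
  exact (extChartAt 𝓘(ℝ, E) (1 : G)).right_inv ha

theorem contMDiffAt_oneChart : ContMDiffAt 𝓘(ℝ, E) 𝓘(ℝ, E) ∞ (oneChart E G) 1 :=
  have := LieGroup.toContMDiffMul (I := 𝓘(ℝ, E)) (n := ∞) (G := G)
  contMDiffAt_extChartAt

theorem contMDiffAt_oneChartSymm :
    ContMDiffAt 𝓘(ℝ, E) 𝓘(ℝ, E) ∞ (oneChartSymm E G) (oneChart E G 1) :=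
  (contMDiffOn_extChartAt_symm (1 : G)).contMDiffAt (extChartAt_target_mem_nhds (1 : G))

theorem continuousAt_oneChart : ContinuousAt (oneChart E G) 1 := contMDiffAt_oneChart.continuousAt

theorem continuousAt_oneChartSymm : ContinuousAt (oneChartSymm E G) (oneChart E G 1) :=
  contMDiffAt_oneChartSymm.continuousAt

theorem contDiffAt_oneChart_comp {Z : Type*} [NormedAddCommGroup Z] [NormedSpace ℝ Z] {f : Z → G}
    {z : Z} (hf : ContMDiffAt 𝓘(ℝ, Z) 𝓘(ℝ, E) ∞ f z) (hz : f z = 1) :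
    ContDiffAt ℝ ∞ (fun x ↦ oneChart E G (f x)) z := by
  refine ContMDiffAt.contDiffAt (ContMDiffAt.comp (I' := 𝓘(ℝ, E)) z ?_ hf)
  rw [hz]
  exact contMDiffAt_oneChart

theorem contMDiffAt_oneChartSymm_comp {Z : Type*} [NormedAddCommGroup Z] [NormedSpace ℝ Z]
    {f : Z → E} {z : Z} (hf : ContDiffAt ℝ ∞ f z) (hz : f z = oneChart E G 1) :
    ContMDiffAt 𝓘(ℝ, Z) 𝓘(ℝ, E) ∞ (fun x ↦ oneChartSymm E G (f x)) z := by
  refine ContMDiffAt.comp (I' := 𝓘(ℝ, E)) z ?_ hf.contMDiffAt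
  rw [hz]
  exact contMDiffAt_oneChartSymm

variable (E G) in
-- Multiplication restricted to either factor through the identity is the identity map, so its
-- derivative is addition, and along the diagonal this is doubling.
theorem hasFDerivAt_oneChart_sq : HasFDerivAt
    (fun a ↦ oneChart E G (oneChartSymm E G a * oneChartSymm E G a))
    ((2 : ℝ) • ContinuousLinearMap.id ℝ E) (oneChart E G 1) := by
  set a₀ := oneChart E G 1 with ha₀
  let m : E × E → E := fun p ↦ oneChart E G (oneChartSymm E G p.1 * oneChartSymm E G p.2)
  have hm : ContDiffAt ℝ ∞ m (a₀, a₀) := by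
    refine contDiffAt_oneChart_comp (ContMDiffAt.mul
      (contMDiffAt_oneChartSymm_comp contDiffAt_fst rfl)
      (contMDiffAt_oneChartSymm_comp contDiffAt_snd rfl)) ?_
    simp only [ha₀, oneChartSymm_oneChart_one, mul_one]
  have hD := (hm.differentiableAt (by simp)).hasFDerivAt
  set D := fderiv ℝ m (a₀, a₀)
  have h1 : D.comp (.inl ℝ E E) = .id ℝ E := by
    have e1 : HasFDerivAt (fun a ↦ m (a, a₀)) (D.comp (.inl ℝ E E)) a₀ :=
      HasFDerivAt.comp (f := fun a ↦ (a, a₀)) a₀ hD (hasFDerivAt_prodMk_left a₀ a₀)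
    refine e1.unique ((hasFDerivAt_id a₀).congr_of_eventuallyEq ?_)
    filter_upwards [eventually_oneChart_oneChartSymm (E := E) (G := G)] with a ha
    simp only [m, ha₀, oneChartSymm_oneChart_one, mul_one, ha, id]
  have h2 : D.comp (.inr ℝ E E) = .id ℝ E := by
    have e1 : HasFDerivAt (fun a ↦ m (a₀, a)) (D.comp (.inr ℝ E E)) a₀ :=
      HasFDerivAt.comp a₀ hD (hasFDerivAt_prodMk_right a₀ a₀)
    refine e1.unique ((hasFDerivAt_id a₀).congr_of_eventuallyEq ?_)
    filter_upwards [eventually_oneChart_oneChartSymm (E := E) (G := G)] with a ha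
    simp only [m, ha₀, oneChartSymm_oneChart_one, one_mul, ha, id]
  have h3 : HasFDerivAt (fun a ↦ m (a, a))
      (D.comp ((ContinuousLinearMap.id ℝ E).prod (ContinuousLinearMap.id ℝ E))) a₀ :=
    HasFDerivAt.comp (f := fun a : E ↦ (a, a)) a₀ hD ((hasFDerivAt_id a₀).prodMk (hasFDerivAt_id a₀))
  convert h3 using 1
  ext v
  have e1 := DFunLike.congr_fun h1 v
  have e2 := DFunLike.congr_fun h2 v
  simp only [ContinuousLinearMap.comp_apply, ContinuousLinearMap.inl_apply,
    ContinuousLinearMap.inr_apply, ContinuousLinearMap.id_apply] at e1 e2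
  have e3 : D (v, v) = D (v, 0) + D (0, v) := by rw [← map_add]; simp
  simp [e3, e1, e2, two_smul]

variable (E G) in
include E in
/-- Lie groups have no small subgroups. -/
theorem exists_nhds_subgroup_eq_bot :
    ∃ W ∈ 𝓝 (1 : G), ∀ L : Subgroup G, (L : Set G) ⊆ W → L = ⊥ := by
  set a₀ := oneChart E G 1 with ha₀
  -- Any factor in `(1, 2)` would do: the derivative doubles and the error is at most half the
  -- distance.
  have h1 : ∀ᶠ a in 𝓝 a₀, 3 / 2 * ‖a - a₀‖ ≤
      ‖oneChart E G (oneChartSymm E G a * oneChartSymm E G a) - a₀‖ := by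
    have h := (hasFDerivAt_oneChart_sq E G).isLittleO.bound (show (0 : ℝ) < 1 / 2 by norm_num)
    filter_upwards [h] with a ha
    have h0 : oneChart E G (oneChartSymm E G a₀ * oneChartSymm E G a₀) = a₀ := by
      rw [ha₀, oneChartSymm_oneChart_one, mul_one]
    rw [← ha₀, h0, norm_sub_rev] at ha
    have e1 : ‖((2 : ℝ) • ContinuousLinearMap.id ℝ E) (a - a₀)‖ = 2 * ‖a - a₀‖ := by
      rw [smul_apply, ContinuousLinearMap.id_apply, norm_smul]
      norm_num
    have e2 := norm_sub_norm_le (((2 : ℝ) • ContinuousLinearMap.id ℝ E) (a - a₀))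
      (oneChart E G (oneChartSymm E G a * oneChartSymm E G a) - a₀)
    rw [e1] at e2
    linarith
  have h2 : ∀ᶠ g in 𝓝 (1 : G), ‖oneChart E G g - a₀‖ < 1 := by
    have : Tendsto (fun g ↦ ‖oneChart E G g - a₀‖) (𝓝 1) (𝓝 ‖a₀ - a₀‖) :=
      ((continuousAt_oneChart (E := E) (G := G)).sub continuousAt_const).norm
    rw [sub_self, norm_zero] at this
    exact this.eventually_lt_const one_pos
  refine ⟨_, Filter.inter_mem (Filter.inter_mem (continuousAt_oneChart.eventually h1) h2)
    (eventually_oneChartSymm_oneChart (E := E)), fun L hL ↦ ?_⟩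
  rw [Subgroup.eq_bot_iff_forall]
  intro g hg
  -- All powers of `g` stay in `L`, hence in the good neighbourhood, so repeated squaring expands
  -- the distance to the identity without end, against the bound `1`.
  have hpow : ∀ i : ℕ, (3 / 2 : ℝ) ^ i * ‖oneChart E G g - a₀‖ ≤
      ‖oneChart E G (g ^ 2 ^ i) - a₀‖ := fun i ↦ by
    induction i with
    | zero => simp
    | succ i ih =>
      obtain ⟨⟨e1, _⟩, e3⟩ := hL (L.pow_mem hg (2 ^ i))
      simp only [Set.mem_ofPred_eq] at e1 e3
      rw [e3] at e1
      calc (3 / 2 : ℝ) ^ (i + 1) * ‖oneChart E G g - a₀‖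
          = 3 / 2 * ((3 / 2 : ℝ) ^ i * ‖oneChart E G g - a₀‖) := by ring
        _ ≤ 3 / 2 * ‖oneChart E G (g ^ 2 ^ i) - a₀‖ := by gcongr
        _ ≤ _ := e1
        _ = _ := by rw [pow_succ 2 i, pow_mul, pow_two]
  have hzero : ‖oneChart E G g - a₀‖ = 0 := by
    by_contra hne
    have hpos : 0 < ‖oneChart E G g - a₀‖ := lt_of_le_of_ne (norm_nonneg _) (Ne.symm hne)
    obtain ⟨i, hi⟩ := pow_unbounded_of_one_lt (‖oneChart E G g - a₀‖⁻¹) (show (1 : ℝ) < 3 / 2 by norm_num)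
    have h3 := hpow i
    have h4 : ‖oneChart E G (g ^ 2 ^ i) - a₀‖ < 1 := (hL (L.pow_mem hg (2 ^ i))).1.2
    have h5 := mul_lt_mul_of_pos_right hi hpos
    rw [inv_mul_cancel₀ hne] at h5
    linarith
  have h6 : oneChartSymm E G (oneChart E G g) = g := (hL hg).2
  rw [← h6, sub_eq_zero.1 (norm_eq_zero.1 hzero), ha₀, oneChartSymm_oneChart_one]

/-! ### Rigidity of homomorphisms from a finite group. -/

section Rigidity

variable [CompleteSpace E] {F : Type*} [Group F] (ρ : F →* G)

variable (E) in
/-- Conjugation by `ρ f` in the chart at the identity. -/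
noncomputable def chartConj (f : F) (a : E) : E :=
  oneChart E G (ρ f * oneChartSymm E G a * (ρ f)⁻¹)

omit [CompleteSpace E] in
theorem contDiffAt_chartConj (f : F) :
    ContDiffAt ℝ ∞ (chartConj E ρ f) (oneChart E G 1) := by
  refine contDiffAt_oneChart_comp (((contMDiffAt_const (c := ρ f)).mul
    contMDiffAt_oneChartSymm).mul contMDiffAt_const) ?_
  simp [oneChartSymm_oneChart_one]

omit [CompleteSpace E] [LieGroup 𝓘(ℝ, E) ∞ G] in
theorem chartConj_one_apply (f : F) :
    chartConj E ρ f (oneChart E G 1) = oneChart E G 1 := by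
  simp [chartConj, oneChartSymm_oneChart_one]

variable (E) in
/-- The adjoint representation of `F` on the model space. -/
noncomputable def chartAd (f : F) : E →L[ℝ] E := fderiv ℝ (chartConj E ρ f) (oneChart E G 1)

omit [CompleteSpace E] in
theorem hasFDerivAt_chartConj (f : F) :
    HasFDerivAt (chartConj E ρ f) (chartAd E ρ f) (oneChart E G 1) :=
  ((contDiffAt_chartConj ρ f).differentiableAt (by simp)).hasFDerivAt

omit [CompleteSpace E] in
theorem eventually_oneChartSymm_chartConj (f : F) : ∀ᶠ a in 𝓝 (oneChart E G 1),
    oneChartSymm E G (chartConj E ρ f a) = ρ f * oneChartSymm E G a * (ρ f)⁻¹ := by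
  have : ContinuousAt (fun a ↦ ρ f * oneChartSymm E G a * (ρ f)⁻¹) (oneChart E G 1) :=
    (((contMDiffAt_const (I := 𝓘(ℝ, E)) (I' := 𝓘(ℝ, E)) (n := ∞) (c := ρ f)).mul
      contMDiffAt_oneChartSymm).mul contMDiffAt_const).continuousAt
  rw [ContinuousAt, oneChartSymm_oneChart_one, mul_one, mul_inv_cancel] at this
  exact this.eventually eventually_oneChartSymm_oneChart

omit [CompleteSpace E] in
theorem chartAd_mul (f f' : F) : chartAd E ρ (f * f') = (chartAd E ρ f).comp (chartAd E ρ f') := by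
  have h1 : HasFDerivAt (chartConj E ρ f ∘ chartConj E ρ f')
      ((chartAd E ρ f).comp (chartAd E ρ f')) (oneChart E G 1) := by
    refine HasFDerivAt.comp _ ?_ (hasFDerivAt_chartConj ρ f')
    rw [chartConj_one_apply]
    exact hasFDerivAt_chartConj ρ f
  refine (hasFDerivAt_chartConj ρ (f * f')).unique (h1.congr_of_eventuallyEq ?_)
  filter_upwards [eventually_oneChartSymm_chartConj ρ f'] with a ha
  rw [Function.comp_apply, chartConj, chartConj, ha, map_mul]
  congr 1
  group

omit [CompleteSpace E] in
theorem chartAd_one : chartAd E ρ 1 = .id ℝ E := by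
  refine (hasFDerivAt_chartConj ρ 1).unique ((hasFDerivAt_id _).congr_of_eventuallyEq ?_)
  filter_upwards [eventually_oneChart_oneChartSymm (E := E) (G := G)] with a ha
  simp [chartConj, ha]

variable [Fintype F]

variable (E) in
/-- The average over `F` of the positions of the points `ρ f * g * (ρ' f)⁻¹`, transported back to
the identity. -/
noncomputable def chartAverage (g : G) (q : F → G) : E :=
  ∑ f, chartAd E ρ f⁻¹ (oneChart E G (ρ f * g * q f) - oneChart E G 1)

omit [CompleteSpace E] in
-- Reindexing the sum by right translation by `f` produces the factor `chartAd f`. Hence the zeros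
-- `g` of the average are stable under `g ↦ ρ(f) g ρ'(f)⁻¹`.
theorem chartAverage_mul (g : G) (ρ' : F →* G) (f : F) :
    chartAverage E ρ (ρ f * g * (ρ' f)⁻¹) (fun f ↦ (ρ' f)⁻¹) =
      chartAd E ρ f (chartAverage E ρ g fun f ↦ (ρ' f)⁻¹) := by
  rw [chartAverage, chartAverage, map_sum]
  refine Fintype.sum_equiv (Equiv.mulRight f) _ _ fun f' ↦ ?_
  rw [← ContinuousLinearMap.comp_apply, ← chartAd_mul]
  simp [mul_assoc]

omit [CompleteSpace E] in
theorem contDiffAt_chartAverage : ContDiffAt ℝ ∞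
    (fun p : (F → E) × E ↦ chartAverage E ρ (oneChartSymm E G p.2)
      fun f ↦ (ρ f)⁻¹ * oneChartSymm E G (p.1 f))
    (fun _ ↦ oneChart E G 1, oneChart E G 1) := by
  refine ContDiffAt.sum fun f _ ↦ ContDiffAt.continuousLinearMap_comp _
    (ContDiffAt.sub (contDiffAt_oneChart_comp ?_ ?_) contDiffAt_const)
  · refine (contMDiffAt_const.mul (contMDiffAt_oneChartSymm_comp contDiffAt_snd rfl)).mul
      (contMDiffAt_const.mul (contMDiffAt_oneChartSymm_comp ?_ rfl))
    exact ((contDiff_apply ℝ E f).contDiffAt).comp _ contDiffAt_fst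
  · simp [oneChartSymm_oneChart_one]

omit [CompleteSpace E] in
-- At `ρ' = ρ` each summand is conjugation by `ρ f` followed by `chartAd f⁻¹`, with derivative the
-- identity. The total, `|F|` times the identity, is invertible, as the implicit function theorem
-- requires.
theorem hasFDerivAt_chartAverage : HasFDerivAt
    (fun a : E ↦ chartAverage E ρ (oneChartSymm E G a)
      fun f ↦ (ρ f)⁻¹ * oneChartSymm E G (oneChart E G 1))
    ((Fintype.card F : ℝ) • ContinuousLinearMap.id ℝ E) (oneChart E G 1) := by
  have h : HasFDerivAt (fun a : E ↦ ∑ f, chartAd E ρ f⁻¹ (chartConj E ρ f a - oneChart E G 1))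
      (∑ f, (chartAd E ρ f⁻¹).comp (chartAd E ρ f)) (oneChart E G 1) :=
    HasFDerivAt.fun_sum fun f _ ↦ (chartAd E ρ f⁻¹).hasFDerivAt.comp _
      ((hasFDerivAt_chartConj ρ f).sub_const _)
  convert h using 1
  · funext a
    simp [chartAverage, chartConj, oneChartSymm_oneChart_one]
  · simp [← chartAd_mul, chartAd_one, Nat.cast_smul_eq_nsmul]

variable (E) in
include E in
/-- Homomorphisms from a finite group which are close to `ρ` are conjugate to `ρ`. -/
theorem eventually_conj : ∀ᶠ w in 𝓝 (1 : F → G), ∀ ρ' : F →* G,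
    (∀ f, w f = ρ f * (ρ' f)⁻¹) → ∃ g, ∀ f, ρ f * g = g * ρ' f := by
  have hG : IsTopologicalGroup G := topologicalGroup_of_lieGroup 𝓘(ℝ, E) ∞
  set a₀ := oneChart E G 1 with ha₀
  -- The first variable encodes `w f = ρ(f) ρ'(f)⁻¹` in the chart, so that `ρ(f)⁻¹ w f` is
  -- `ρ'(f)⁻¹`; the second encodes `g`.
  let Ψ : (F → E) × E → E := fun p ↦ chartAverage E ρ (oneChartSymm E G p.2)
      fun f ↦ (ρ f)⁻¹ * oneChartSymm E G (p.1 f)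
  have hΨ : ContDiffAt ℝ ∞ Ψ (fun _ ↦ a₀, a₀) := contDiffAt_chartAverage ρ
  have hΨ0 : Ψ (fun _ ↦ a₀, a₀) = 0 := by
    simp [Ψ, ha₀, chartAverage, oneChartSymm_oneChart_one]
  have hne : (∞ : WithTop ℕ∞) ≠ 0 := by simp
  have hinv : (fderiv ℝ Ψ (fun _ ↦ a₀, a₀) ∘L .inr ℝ (F → E) E).IsInvertible := by
    have e1 : HasFDerivAt (fun a ↦ Ψ (fun _ ↦ a₀, a))
        ((fderiv ℝ Ψ (fun _ ↦ a₀, a₀)).comp (.inr ℝ (F → E) E)) a₀ :=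
      HasFDerivAt.comp a₀ (hΨ.differentiableAt hne).hasFDerivAt
        (hasFDerivAt_prodMk_right (fun _ ↦ a₀) a₀)
    rw [e1.unique (hasFDerivAt_chartAverage ρ)]
    have hc : (Fintype.card F : ℝ) ≠ 0 := Nat.cast_ne_zero.2 Fintype.card_ne_zero
    refine .of_inverse (g := (Fintype.card F : ℝ)⁻¹ • ContinuousLinearMap.id ℝ E) ?_ ?_ <;>
    · ext v; simp [smul_smul, hc]
  set ι := hΨ.implicitFunction hne hinv
  have hι : ContinuousAt ι (fun _ ↦ a₀) :=
    (hΨ.contDiffAt_implicitFunction hne hinv).continuousAt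
  have hι0 : ι (fun _ ↦ a₀) = a₀ := hΨ.implicitFunction_apply_self hne hinv
  have hw : Tendsto (fun (w : F → G) f ↦ oneChart E G (w f)) (𝓝 1) (𝓝 fun _ ↦ a₀) :=
    tendsto_pi_nhds.2 fun f ↦ Tendsto.comp (y := 𝓝 (1 : G)) continuousAt_oneChart
      ((continuous_apply f).tendsto' 1 1 rfl)
  have hv : Tendsto (fun w : F → G ↦ ι fun f ↦ oneChart E G (w f)) (𝓝 1) (𝓝 a₀) := by
    have := hι.tendsto.comp hw
    rwa [hι0] at this
  have hg : Tendsto (fun w : F → G ↦ oneChartSymm E G (ι fun f ↦ oneChart E G (w f)))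
      (𝓝 1) (𝓝 1) := by
    have := (continuousAt_oneChartSymm (E := E) (G := G)).tendsto.comp hv
    rwa [oneChartSymm_oneChart_one] at this
  have hh : ∀ f : F, Tendsto (fun w : F → G ↦
      ρ f * oneChartSymm E G (ι fun f ↦ oneChart E G (w f)) * ((ρ f)⁻¹ * w f)) (𝓝 1) (𝓝 1) :=
    fun f ↦ by
    have := (hg.const_mul (ρ f)).mul (((continuous_apply f).tendsto' (1 : F → G) 1 rfl).const_mul
      (ρ f)⁻¹)
    simpa using this
  have E1 := hw.eventually (hΨ.eventually_apply_implicitFunction hne hinv)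
  have E2 := Filter.eventually_all.2 fun f : F ↦
    (hw.prodMk_nhds (Tendsto.comp (y := 𝓝 (1 : G)) continuousAt_oneChart (hh f))).eventually
    (hΨ.eventually_apply_eq_iff_implicitFunction hne hinv)
  have E3 := Filter.eventually_all.2 fun f : F ↦
    ((continuous_apply f).tendsto' (1 : F → G) 1 rfl).eventually
      (eventually_oneChartSymm_oneChart (E := E))
  have E4 := Filter.eventually_all.2 fun f : F ↦
    (hh f).eventually (eventually_oneChartSymm_oneChart (E := E))
  filter_upwards [E1, E2, E3, E4] with w e1 e2 e3 e4 ρ' hρ'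
  set g := oneChartSymm E G (ι fun f ↦ oneChart E G (w f)) with hgdef
  have hwq : ∀ f, (ρ f)⁻¹ * w f = (ρ' f)⁻¹ := fun f ↦ by rw [hρ', inv_mul_cancel_left]
  refine ⟨g, fun f ↦ ?_⟩
  have k1 : chartAverage E ρ g (fun f ↦ (ρ' f)⁻¹) = 0 := by
    have := e1.trans hΨ0
    simp only [Ψ, e3, hwq] at this
    exact this
  simp only [hwq] at e4
  -- Both `g` and `ρ(f) g ρ'(f)⁻¹` are zeros near the identity, and the implicit function theorem
  -- allows only one.
  have k2 := (e2 f).1 (by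
    rw [hΨ0]
    simp only [Ψ, Function.comp_apply, e4, e3, hwq, chartAverage_mul, ← hgdef, k1, map_zero])
  have k3 := congrArg (oneChartSymm E G) k2
  simp only [Function.comp_apply] at k3
  rw [hwq, e4] at k3
  exact mul_inv_eq_iff_eq_mul.1 k3.symm

end Rigidity

end LieGroups

/-! ### Nearby isotropy groups and finiteness of the classes. -/

section Isotropy

open Filter

section Nearby

variable (E : Type*) [NormedAddCommGroup E] [NormedSpace ℝ E] [CompleteSpace E]
  {G : Type*} [Group G] [TopologicalSpace G] [ChartedSpace E G] [LieGroup 𝓘(ℝ, E) ∞ G] [T1Space G]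

include E

/-- A subgroup of a Lie group which is close to a finite subgroup `K` is conjugate to a subgroup
of `K`. -/
theorem exists_nhds_conj_mem (K : Subgroup G) [Finite K] :
    ∃ W ∈ 𝓝 (1 : G), ∀ L : Subgroup G, (∀ l ∈ L, ∃ k ∈ K, k * l⁻¹ ∈ W) →
      ∃ g : G, ∀ l ∈ L, g * l * g⁻¹ ∈ K := by
  have hG : IsTopologicalGroup G := topologicalGroup_of_lieGroup 𝓘(ℝ, E) ∞
  -- The subgroup of `K` that `L` will match is not known in advance; there are only finitely many,
  -- so their neighbourhoods can be intersected.
  have hrig : ∀ K' : Subgroup K, ∃ V ∈ 𝓝 (1 : G), ∀ ρ' : K' →* G,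
      (∀ f : K', ((f : K) : G) * (ρ' f)⁻¹ ∈ V) →
        ∃ g : G, ∀ f : K', ((f : K) : G) * g = g * ρ' f := fun K' ↦ by
    have : Fintype K' := Fintype.ofFinite K'
    have h := eventually_conj E (K.subtype.comp K'.subtype)
    rw [nhds_pi, Filter.eventually_iff, Filter.mem_pi] at h
    obtain ⟨I, -, t, ht, hsub⟩ := h
    refine ⟨⋂ i, t i, (Filter.iInter_mem).2 ht, fun ρ' hρ' ↦ ?_⟩
    exact hsub (fun i _ ↦ Set.mem_iInter.1 (hρ' i) i) ρ' fun f ↦ rfl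
  choose V hV hconj using hrig
  obtain ⟨S, hS, hSbot⟩ := exists_nhds_subgroup_eq_bot E G
  have hN : ((K : Set G) \ {1})ᶜ ∈ 𝓝 (1 : G) :=
    ((Set.toFinite (K : Set G)).subset Set.sdiff_subset).isClosed.isOpen_compl.mem_nhds (by simp)
  have hT : ∀ᶠ p in 𝓝 ((1 : G), (1 : G), (1 : G)), ∀ k : K,
      p.1 * (k * p.2.1 * (k : G)⁻¹ * p.2.2)⁻¹ ∈ ((K : Set G) \ {1})ᶜ := by
    refine Filter.eventually_all.2 fun k ↦ ?_
    have hc : Continuous fun p : G × G × G ↦ p.1 * (k * p.2.1 * (k : G)⁻¹ * p.2.2)⁻¹ := by fun_prop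
    exact (hc.tendsto' (1, 1, 1) 1 (by simp)).eventually hN
  rw [nhds_prod_eq, nhds_prod_eq, Filter.eventually_iff, Filter.mem_prod_iff] at hT
  obtain ⟨T₁, hT₁, T', hT', hT⟩ := hT
  obtain ⟨T₂, hT₂, T₃, hT₃, hT''⟩ := Filter.mem_prod_iff.1 hT'
  have hT : ∀ a ∈ T₁, ∀ b ∈ T₂, ∀ c ∈ T₃, ∀ k ∈ K, a * (k * b * k⁻¹ * c)⁻¹ ∈ K →
      a * (k * b * k⁻¹ * c)⁻¹ = 1 := fun a ha b hb c hc k hk hm ↦ by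
    have := hT (Set.mk_mem_prod ha (hT'' (Set.mk_mem_prod hb hc))) ⟨k, hk⟩
    by_contra hne
    exact this ⟨hm, hne⟩
  have hSinv : S⁻¹ ∈ 𝓝 (1 : G) := inv_mem_nhds_one G hS
  refine ⟨((T₁ ∩ T₂ ∩ T₃) ∩ S⁻¹) ∩ ⋂ K', V K', ?_, fun L hL ↦ ?_⟩
  · exact inter_mem (inter_mem (inter_mem (inter_mem hT₁ hT₂) hT₃) hSinv)
      (Filter.iInter_mem.2 hV)
  choose! j hjK hjW using hL
  -- The defect `j(l l') (j(l) j(l'))⁻¹` lies in `K` and is close to `1`; the elements of `K` other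
  -- than `1` have been kept away from it.
  have hmul : ∀ l ∈ L, ∀ l' ∈ L, j (l * l') = j l * j l' := fun l hl l' hl' ↦ by
    have h := hT _ (hjW _ (L.mul_mem hl hl')).1.1.1.1 _ (hjW l' hl').1.1.1.2 _ (hjW l hl).1.1.2
      (j l) (hjK l hl)
    have e : j (l * l') * (l * l')⁻¹ * (j l * (j l' * l'⁻¹) * (j l)⁻¹ * (j l * l⁻¹))⁻¹ =
        j (l * l') * (j l * j l')⁻¹ := by group
    rw [e] at h
    exact mul_inv_eq_one.1
      (h (K.mul_mem (hjK _ (L.mul_mem hl hl')) (K.inv_mem (K.mul_mem (hjK l hl) (hjK l' hl')))))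
  let J : L →* K := MonoidHom.mk' (fun l ↦ ⟨j l, hjK l l.2⟩) fun a b ↦
    Subtype.ext (hmul a a.2 b b.2)
  have hJ : Function.Injective J := by
    rw [← MonoidHom.ker_eq_bot_iff]
    -- If `j l = 1`, then `l⁻¹ ∈ S⁻¹`; the kernel is thus a subgroup contained in `S`.
    have h1 : J.ker.map L.subtype = ⊥ := hSbot _ fun g hg ↦ by
      obtain ⟨l, hl, rfl⟩ := hg
      have h2 : j l = 1 := congrArg Subtype.val (MonoidHom.mem_ker.1 hl)
      have h3 : j l * (l : G)⁻¹ ∈ S⁻¹ := (hjW l l.2).1.2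
      rw [h2, one_mul] at h3
      simpa using h3
    exact (Subgroup.map_eq_bot_iff_of_injective _ L.subtype_injective).1 h1
  let e := MonoidHom.ofInjective hJ
  -- Rigidity compares the inclusion of `J(L)` in `G` with the inverse of `J`, which is close to it.
  obtain ⟨g, hg⟩ := hconj J.range (L.subtype.comp e.symm.toMonoidHom) fun f ↦ by
    obtain ⟨l, rfl⟩ := e.surjective f
    have : (L.subtype.comp e.symm.toMonoidHom) (e l) = l := by simp
    rw [this]
    exact Set.mem_iInter.1 (hjW l l.2).2 _
  refine ⟨g, fun l hl ↦ ?_⟩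
  have h := hg (e ⟨l, hl⟩)
  have h1 : (L.subtype.comp e.symm.toMonoidHom) (e ⟨l, hl⟩) = l := by simp
  rw [h1] at h
  rw [← h, mul_inv_cancel_right]
  exact hjK l hl

variable [CompactSpace G] {M : Type*} [TopologicalSpace M] [T2Space M] [MulAction G M]
  [ContinuousSMul G M]

omit E [T1Space G] in
-- The elements not close to the isotropy group of `x` form a compact set, each of them moves `x`,
-- and so all of them move every point sufficiently near `x`.
theorem eventually_stabilizer_close (x : M) {W : Set G} (hW : W ∈ 𝓝 (1 : G))
    [IsTopologicalGroup G] :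
    ∀ᶠ y in 𝓝 x, ∀ g ∈ MulAction.stabilizer G y, ∃ k ∈ MulAction.stabilizer G x, k * g⁻¹ ∈ W := by
  let C : Set G := {g | ∀ k ∈ MulAction.stabilizer G x, k * g⁻¹ ∉ interior W}
  have hC : IsCompact C := by
    refine IsClosed.isCompact ?_
    have : C = ⋂ k ∈ MulAction.stabilizer G x, (fun g : G ↦ k * g⁻¹) ⁻¹' (interior W)ᶜ := by
      ext g; simp [C]
    rw [this]
    exact isClosed_biInter fun k _ ↦ isOpen_interior.isClosed_compl.preimage (by fun_prop)
  have h := hC.eventually_forall_of_forall_eventually (x₀ := x) (P := fun y g ↦ g • y ≠ y)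
    fun g hg ↦ by
      have hne : g • x ≠ x := fun hgx ↦ hg g hgx (by
        rw [mul_inv_cancel]; exact mem_interior_iff_mem_nhds.2 hW)
      have hopen : IsOpen {z : M × G | z.2 • z.1 ≠ z.1} :=
        isOpen_ne_fun (continuous_snd.smul continuous_fst) continuous_fst
      exact hopen.mem_nhds hne
  filter_upwards [h] with y hy g hg
  by_contra! hcon
  exact hy g (fun k hk hm ↦ hcon k hk (interior_subset hm)) hg

/-- In a locally free action of a compact Lie group, isotropy groups near `x` are conjugate to
subgroups of the isotropy group of `x`. -/
theorem eventually_stabilizer_conj (x : M) [Finite (MulAction.stabilizer G x)] :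
    ∀ᶠ y in 𝓝 x, ∃ g : G, ∀ l ∈ MulAction.stabilizer G y, g * l * g⁻¹ ∈ MulAction.stabilizer G x := by
  have hG : IsTopologicalGroup G := topologicalGroup_of_lieGroup 𝓘(ℝ, E) ∞
  obtain ⟨W, hW, h⟩ := exists_nhds_conj_mem E (MulAction.stabilizer G x)
  filter_upwards [eventually_stabilizer_close x hW] with y hy
  exact h _ hy

end Nearby

theorem finite_stabilizer {G M : Type*} [Group G] [TopologicalSpace G] [CompactSpace G]
    [TopologicalSpace M] [T1Space M] [MulAction G M] [ContinuousSMul G M] (x : M)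
    [DiscreteTopology (MulAction.stabilizer G x)] : Finite (MulAction.stabilizer G x) := by
  have hcl : IsClosed (MulAction.stabilizer G x : Set G) :=
    isClosed_singleton.preimage (continuous_id.smul continuous_const : Continuous fun g : G ↦ g • x)
  have : CompactSpace (MulAction.stabilizer G x) := isCompact_iff_compactSpace.1 hcl.isCompact
  exact finite_of_compact_of_discrete

theorem finite_monoidHom_of_fg (A B : Type*) [Group A] [Group.FG A] [Group B] [Finite B] :
    Finite (A →* B) := by
  obtain ⟨S, hS⟩ := Group.FG.out (G := A)
  refine Finite.of_injective (fun (f : A →* B) (s : S) ↦ f s) fun f f' h ↦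
    MonoidHom.eq_of_eqOn_dense hS fun s hs ↦ congrFun h ⟨s, hs⟩

/-- Finitely many of the neighbourhoods on which isotropy is conjugate into that of the centre cover
`M`. A `ρ` with a fixed point is therefore conjugate to a homomorphism into one of finitely many
finite groups; conjugation by `G` alone suffices, so `u = 1`. -/
theorem finite_normalizerClass_fixedSet (E : Type*) [NormedAddCommGroup E] [NormedSpace ℝ E]
    [CompleteSpace E] {Γ G M : Type u} [Group Γ] [Group G] [TopologicalSpace G] [ChartedSpace E G]
    [LieGroup 𝓘(ℝ, E) ∞ G] [T1Space G] [CompactSpace G] [TopologicalSpace M] [T2Space M]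
    [CompactSpace M] [MulAction G M] [ContinuousSMul G M]
    (hfree : ∀ x : M, DiscreteTopology (MulAction.stabilizer G x))
    (H : Subgroup Γ) [Group.FG H] :
    {c : NormalizerClass H G | (fixedSet c.out M).Nonempty}.Finite := by
  have hfin : ∀ x : M, Finite (MulAction.stabilizer G x) := fun x ↦
    have := hfree x
    finite_stabilizer x
  obtain ⟨t, ht⟩ := CompactSpace.elim_nhds_subcover _ fun x : M ↦
    eventually_stabilizer_conj E (G := G) x
  have hhom : ∀ x : M, Finite (H →* MulAction.stabilizer G x) := fun x ↦ finite_monoidHom_of_fg _ _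
  refine (t.finite_toSet.biUnion fun x _ ↦ Set.finite_range fun θ : H →* MulAction.stabilizer G x ↦
    (Quotient.mk _ ((MulAction.stabilizer G x).subtype.comp θ) : NormalizerClass H G)).subset ?_
  rintro c ⟨y, hy⟩
  have hy' : y ∈ ⋃ x ∈ t, {y | ∃ g : G, ∀ l ∈ MulAction.stabilizer G y,
      g * l * g⁻¹ ∈ MulAction.stabilizer G x} := by rw [ht]; trivial
  simp only [Set.mem_iUnion] at hy'
  obtain ⟨x, hx, g, hg⟩ := hy'
  simp only [Set.mem_iUnion]
  refine ⟨x, hx, ((MulAut.conj g).toMonoidHom.comp c.out).codRestrict _ fun h ↦ hg _ (hy h), ?_⟩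
  refine Eq.trans ?_ c.out_eq
  refine Quotient.sound (s := normalizerSetoid H G) ⟨1, g, MonoidHom.ext fun h ↦ ?_⟩
  change c.out h = g⁻¹ * (g * c.out _ * g⁻¹) * g
  have : (⟨((1 : Subgroup.normalizer (H : Set Γ)) : Γ) * h *
      (((1 : Subgroup.normalizer (H : Set Γ)) : Γ))⁻¹,
      (Subgroup.mem_normalizer_iff.1 (1 : Subgroup.normalizer (H : Set Γ)).2 h).1 h.2⟩ : H) = h :=
    Subtype.ext (by simp)
  rw [this]
  group

end Isotropy

/-! ### The bijection of index sets, and the theorem. -/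

section Correspondence

variable {Γ G : Type u} [Group Γ] [Group G] {H : Subgroup Γ} {n : ℕ}

/-- The bijection between `HOM(H, G)/(N_Γ(H) × G)` and `π⁻¹((Γ/H))`, together with framings of the
chosen representatives. -/
theorem exists_bijOn_isFraming (hn : n ≠ 0) (hH : H.index = n) :
    ∃ B : NormalizerClass H G → HomClass Γ (WreathProduct G n),
      Set.BijOn B Set.univ (wreathProj Γ G n ⁻¹' cosetClass H n) ∧
      ∀ c, ∃ i₀ g₀, IsFraming (B c).out c.out i₀ g₀ := by
  have h : ∀ c : NormalizerClass H G, ∃ b : HomClass Γ (WreathProduct G n),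
      ∃ i₀ g₀, IsFraming b.out c.out i₀ g₀ := fun c ↦ by
    obtain ⟨τ, i₀, g₀, F⟩ := exists_isFraming_of_hom hn hH c.out
    -- The representative chosen in the class of `τ` is only conjugate to `τ`, so the framing is
    -- moved along.
    obtain ⟨k, hk⟩ := Quotient.exact (Quotient.out_eq (Quotient.mk (homConjSetoid _ _) τ)).symm
    exact ⟨_, _, _, F.map k hk⟩
  choose B hB using h
  refine ⟨B, ⟨fun c _ ↦ ?_, fun c _ c' _ hcc ↦ ?_, fun b hb ↦ ?_⟩, hB⟩
  · obtain ⟨_, _, F⟩ := hB c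
    rw [← (B c).out_eq]
    exact F.mem
  · obtain ⟨_, _, F⟩ := hB c
    obtain ⟨_, _, F'⟩ := hB c'
    rw [← hcc] at F'
    rw [← c.out_eq, ← c'.out_eq]
    exact Quotient.sound (F.normalizer F')
  · rw [← b.out_eq] at hb
    obtain ⟨ρ, _, _, F⟩ := exists_isFraming_of_mem b.out hb
    obtain ⟨u, g, hug⟩ := Quotient.exact (Quotient.out_eq (Quotient.mk (normalizerSetoid H G) ρ)).symm
    obtain ⟨_, _, F'⟩ := F.translate u g
    rw [← hug] at F'
    obtain ⟨_, _, F''⟩ := hB (Quotient.mk _ ρ)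
    refine ⟨Quotient.mk _ ρ, trivial, ?_⟩
    rw [← (B _).out_eq, ← b.out_eq]
    exact Quotient.sound (F''.conj F')

end Correspondence

end OrbifoldExtension

theorem mainTheorem6
    -- a finitely generated discrete group
    {Γ : Type u} [Group Γ] [Group.FG Γ]
    -- a compact connected Lie group
    {k : ℕ} {G : Type u} [Group G] [TopologicalSpace G]
    [ChartedSpace (EuclideanSpace ℝ (Fin k)) G] [LieGroup (𝓡 k) ∞ G]
    [T2Space G] [CompactSpace G] [ConnectedSpace G]
    -- a closed manifold with a smooth locally free action
    {d : ℕ} {M : Type u} [TopologicalSpace M]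
    [ChartedSpace (EuclideanSpace ℝ (Fin d)) M] [IsManifold (𝓡 d) ∞ M]
    [T2Space M] [CompactSpace M]
    [MulAction G M] [ContMDiffSMul (𝓡 k) (𝓡 d) ∞ G M]
    (hfree : ∀ x : M, DiscreteTopology (MulAction.stabilizer G x))
    -- a subgroup of finite index
    (H : Subgroup Γ) (n : ℕ) (hn : n ≠ 0) (hH : H.index = n)
    {R : Type v} [CommRing R] (φ : MultiplicativeOrbifoldInvariant.{u} R) :
    letI : DiffeologicalSpace G := manifoldDiffeology (𝓡 k) G
    letI : DiffeologicalSpace M := manifoldDiffeology (𝓡 d) M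
    {c : NormalizerClass H G | (fixedSet c.out M).Nonempty}.Finite ∧
    {c ∈ wreathProj Γ G n ⁻¹' cosetClass H n | (fixedSet c.out (Fin n → M)).Nonempty}.Finite ∧
    cosetExtension H G M φ =
      ∑ᶠ c ∈ wreathProj Γ G n ⁻¹' cosetClass H n, sectorValue φ (Fin n → M) c.out := by
  let _ : DiffeologicalSpace G := manifoldDiffeology (𝓡 k) G
  let _ : DiffeologicalSpace M := manifoldDiffeology (𝓡 d) M
  -- By Schreier, finite index makes `H` finitely generated, which `finite_normalizerClass_fixedSet`
  -- needs.
  have hFI : H.FiniteIndex := ⟨by rw [hH]; exact hn⟩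
  have hcs : ContinuousSMul G M :=
    ⟨(contMDiff_smul (I := 𝓡 k) (I' := 𝓡 d) (n := ∞) (G := G) (M := M)).continuous⟩
  have hmul : Diffeology.DSmooth (fun x : G × G ↦ x.1 * x.2) := fun m p hp ↦
    have h := isPlot_prod_iff.1 hp
    ContMDiff.mul (I := 𝓡 k) (n := ∞) h.1 h.2
  have hinv : Diffeology.DSmooth (fun x : G ↦ x⁻¹) := fun m p hp ↦
    ContMDiff.inv (I := 𝓡 k) (n := ∞) hp
  have hsmul : ∀ g : G, Diffeology.DSmooth (fun x : M ↦ g • x) := fun g m p hp ↦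
    (contMDiff_smul (I := 𝓡 k) (I' := 𝓡 d) (n := ∞) (G := G) (M := M)).comp
      (contMDiff_const.prodMk hp)
  obtain ⟨B, hB, hF⟩ := exists_bijOn_isFraming (G := G) hn hH
  have hfin := finite_normalizerClass_fixedSet (EuclideanSpace ℝ (Fin k)) hfree H
  refine ⟨hfin, (hfin.image B).subset ?_, ?_⟩
  · rintro b ⟨hb, hne⟩
    obtain ⟨c, -, rfl⟩ := hB.surjOn hb
    obtain ⟨_, _, F⟩ := hF c
    exact ⟨c, F.nonempty_iff.1 hne, rfl⟩
  · rw [cosetExtension, ← finsum_mem_univ]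
    -- The terms are matched one by one along `B`. The two finiteness claims ensure that neither
    -- `finsum` takes its default value, since terms with empty fixed set vanish.
    refine finsum_mem_eq_of_bijOn B hB fun c _ ↦ ?_
    obtain ⟨_, _, F⟩ := hF c
    exact F.bundleValue_eq hmul hinv hsmul φ
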